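/- \textbf{Setting.} Let $G=(\mathcal V,\mathcal E)$ be a directed graph without self-loops on a finite set $\mathcal V$ of $n$ agents; $N_i^-=\{j:(j,i)\in\mathcal E\}$, $d_i^-=|N_i^-|$ and $d_{\max}=\max_{i}d_i^-$. Let $f\ge 0$ be an integer, let $\mathcal F\subseteq\mathcal V$ with $\phi=|\mathcal F|\le f$ be the set of (Byzantine) faulty agents, and $\mathcal N=\mathcal V\setminus\mathcal F$. For a set $\mathcal F'\subseteq \mathcal V$ with $|\mathcal F'|\le f$, a \emph{reduced graph for $\mathcal F'$} is a subgraph of $G$ obtained by removing all agents of $\mathcal F'$ with their edges and then removing at most $f$ further incoming edges at each remaining agent. The \emph{source component} of a directed graph is the set of vertices that have a directed path to every other vertex; the graph contains a source component if this set is non-empty. Let $\tau_b$ be the number of reduced graphs for $\mathcal F$. Assume throughout that for every $\mathcal F'\subseteq\mathcal V$ with $|\mathcal F'|\le f$ every reduced graph for $\mathcal F'$ contains a source component. Let $\mathcal X\subseteq\mathbb R$ be non-empty, closed and convex, let $P_{\mathcal X}$ be the projection onto $\mathcal X$, and let $L$ be a constant. Each agent $i$ has a cost function $h_i:\mathcal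 X\to\mathbb R$ that is convex and continuously differentiable with $L$-Lipschitz derivative satisfying $|h_i'|\le L$ on $\mathcal X$, and whose set of minimizers over $\mathcal X$ is non-empty and compact. Let $(\lambda[t])_{t\ge0}$ be real stepsizes with $\lambda[t]\ge\lambda[t+1]$ for all $t$, $\sum_t\lambda[t]=\infty$ and $\sum_t\lambda[t]^2<\infty$. \textbf{Algorithm 1.} Agent $i$ starts with a state $x_i[0]\in\mathbb R$ (if $x_i[0]\notin\mathcal X$, then $h_i'(x_i[0])$ below stands for an arbitrary real number). In iteration $t\ge1$ every non-faulty agent sends its state $x_i[t-1]$ along its outgoing edges, while a faulty agent sends arbitrary real values, possibly different ones to different receivers. From the $d_i^-$ values received, each non-faulty agent $i$ discards the $f$ smallest and the $f$ largest (ties broken arbitrarily); with $N_i^*[t]$ the senders of the remaining values $w_j[t-1]$, and $w_i[t-1]=x_i[t-1]$, it sets \[ x_i[t]=P_{\mathcal X}\Big[\tfrac{1}{d_i^-+1-2f}\sum_{j\in\{i\}\cup N_i^*[t]}w_j[t-1]-\lambda[t-1]\,h_i'(x_i[t-1])\Big]. \] \textbf{Theorem.} For $\beta\in\mathbb R$ and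 $\gamma\in\mathbb N$ let $\mathcal A(\beta,\gamma)$ be the set of functions $\sum_{i\in\mathcal N}\alpha_ih_i$ with $\alpha_i\ge0$, $\sum_{i\in\mathcal N}\alpha_i=1$ and $|\{i\in\mathcal N:\alpha_i\ge\beta\}|\ge\gamma$, and let $Y(\beta,\gamma)=\bigcup_{p\in\mathcal A(\beta,\gamma)}\arg\min_{x\in\mathcal X}p(x)$. If $\gamma\ge f+1$, the source component of every reduced graph for $\mathcal F$ has at least $\gamma$ elements, and \[ \beta\le\frac{1}{\big(2(d_{\max}+1-2f)\big)^{\tau_b(n-\phi)}}, \] then in every execution of Algorithm 1 (for all initial states and all behaviours of the faulty agents) $Y(\beta,\gamma)$ is non-empty, and for all $i,j\in\mathcal N$ \[ \lim_{t\to\infty}\inf_{y\in Y(\beta,\gamma)}|x_i[t]-y|=0,\qquad \lim_{t\to\infty}|x_i[t]-x_j[t]|=0. \] -/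

import Mathlib

open Filter Topology

namespace ByzOpt

/-- The set `N_i⁻` of incoming neighbours of the agent `i`. -/
noncomputable def inNbrs {V : Type*} [Fintype V] (G : Digraph V) (i : V) : Finset V :=
  open Classical in Finset.univ.filter fun j => G.Adj j i

/-- The incoming degree `d_i⁻`. -/
noncomputable def inDegree {V : Type*} [Fintype V] (G : Digraph V) (i : V) : ℕ :=
  (inNbrs G i).card

/-- `d_max`, the largest incoming degree of an agent. -/
noncomputable def maxInDegree {V : Type*} [Fintype V] (G : Digraph V) : ℕ :=
  Finset.univ.sup (inDegree G)

/-- `H` is a reduced graph of `G` for the set `F` of faulty agents: its agents are the non-faulty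
ones, and it arises from the subgraph of `G` induced on them by removing at most `f` incoming edges
at each agent. -/
def IsReducedGraph {V : Type*} (G : Digraph V) (f : ℕ) (F : Finset V)
    (H : Digraph {v : V // v ∉ F}) : Prop :=
  (∀ i j : {v : V // v ∉ F}, H.Adj i j → G.Adj i j) ∧
    ∀ j : {v : V // v ∉ F}, {i : {v : V // v ∉ F} | G.Adj i j ∧ ¬ H.Adj i j}.ncard ≤ f

/-- `τ_b`, the number of reduced graphs for the set `F` of faulty agents. -/
noncomputable def numReducedGraphs {V : Type*} (G : Digraph V) (f : ℕ) (F : Finset V) : ℕ :=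
  {H : Digraph {v : V // v ∉ F} | IsReducedGraph G f F H}.ncard

/-- The source component: the agents that have a directed path to every other agent. A graph is
said to contain a source component if this set is non-empty. -/
def sourceComponent {W : Type*} (H : Digraph W) : Set W :=
  {v | ∀ w, Relation.ReflTransGen H.Adj v w}

/-- The minimizers of `h` over `X`. -/
def argminOn (X : Set ℝ) (h : ℝ → ℝ) : Set ℝ :=
  {x | x ∈ X ∧ ∀ y ∈ X, h x ≤ h y}

/-- `h` is an admissible cost function on `X` with gradient `h'` and constant `L`. Only the values
of `h` and `h'` on `X` matter. -/
structure Admissible (X : Set ℝ) (L : ℝ) (h h' : ℝ → ℝ) : Prop where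
  convex : ConvexOn ℝ X h
  hasDeriv : ∀ x ∈ X, HasDerivWithinAt h (h' x) X x
  continuous_gradient : ContinuousOn h' X
  lipschitz_gradient : ∀ x ∈ X, ∀ y ∈ X, |h' x - h' y| ≤ L * |x - y|
  bounded_gradient : ∀ x ∈ X, |h' x| ≤ L
  argmin_nonempty : (argminOn X h).Nonempty
  argmin_compact : IsCompact (argminOn X h)

/-- The collection `A(β, γ)` of valid functions: convex combinations of the cost functions of the
non-faulty agents in which at least `γ` weights are at least `β`. -/
def validFunctions {V : Type*} [Fintype V] [DecidableEq V] (F : Finset V) (h : V → ℝ → ℝ)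
    (β : ℝ) (γ : ℕ) : Set (ℝ → ℝ) :=
  {p | ∃ α : V → ℝ, (∀ i ∈ Fᶜ, 0 ≤ α i) ∧ ∑ i ∈ Fᶜ, α i = 1 ∧
    γ ≤ {i : V | i ∈ Fᶜ ∧ β ≤ α i}.ncard ∧ p = fun x => ∑ i ∈ Fᶜ, α i * h i x}

/-- `Y(β, γ)`: the minimizers over `X` of the valid functions. -/
def optimalSet {V : Type*} [Fintype V] [DecidableEq V] (F : Finset V) (h : V → ℝ → ℝ)
    (X : Set ℝ) (β : ℝ) (γ : ℕ) : Set ℝ :=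
  ⋃ p ∈ validFunctions F h β γ, argminOn X p

/-- `z = P_X[u]`, the point of `X` nearest to `u`. -/
def IsProjection (X : Set ℝ) (u z : ℝ) : Prop :=
  z ∈ X ∧ ∀ y ∈ X, |z - u| ≤ |y - u|

/-- `K` consists of the senders in `N` that are left after discarding the senders of the `f`
smallest and of the `f` largest of the values `w`, ties being broken arbitrarily. -/
def IsTrimming {V : Type*} [DecidableEq V] (N : Finset V) (w : V → ℝ) (f : ℕ)
    (K : Finset V) : Prop :=
  ∃ S B : Finset V, S ⊆ N ∧ B ⊆ N ∧ Disjoint S B ∧ S.card = f ∧ B.card = f ∧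
    (∀ s ∈ S, ∀ k ∈ N \ S, w s ≤ w k) ∧ (∀ b ∈ B, ∀ k ∈ N \ B, w k ≤ w b) ∧
    K = N \ (S ∪ B)

/-- An execution of the algorithm with the set `F` of Byzantine agents: `x t i` is the state of
agent `i` after iteration `t` and `w t j i` the value that `i` receives from `j` in iteration
`t + 1`. Non-faulty senders transmit their state; what a faulty agent sends is arbitrary and may
differ from receiver to receiver. The states `x t i` of faulty agents are unconstrained. -/
structure IsExecution {V : Type*} [Fintype V] [DecidableEq V] (G : Digraph V) (f : ℕ)
    (F : Finset V) (X : Set ℝ) (h' : V → ℝ → ℝ) (stepsize : ℕ → ℝ)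
    (x : ℕ → V → ℝ) (w : ℕ → V → V → ℝ) : Prop where
  honest : ∀ t, ∀ j ∉ F, ∀ i ∉ F, G.Adj j i → w t j i = x t j
  update : ∀ t, ∀ i ∉ F, ∃ K : Finset V, IsTrimming (inNbrs G i) (fun j => w t j i) f K ∧
    IsProjection X
      (1 / ((inDegree G i : ℝ) + 1 - 2 * f) * (x t i + ∑ j ∈ K, w t j i)
        - stepsize t * h' i (x t i))
      (x (t + 1) i)

end ByzOpt

/-! Trimming looks nonlinear and adversarial, but seen from the non-faulty agents it is averaging:
each iteration reads `x[t+1] = P_X[M[t] x[t] - λ[t] h'(x[t])]` with `M[t]` row stochastic on these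
agents alone. Put `d = d_max + 1 - 2f` and `m = n - φ`. The diagonal of `M[t]` is at least `1/d`,
and its entries along some reduced graph `H[t]` are at least `(1/d) 2^-(f+1)`
(`IsTrimming.exists_weights`, `IsExecution.exists_matrix`).

In a window of `τ_b m` steps some reduced graph `H` occurs at least `m` times, enough to reach every
agent from every source of `H`. The extra factor `2^-(f+1)` is paid only when an edge is crossed, at
most `m` times, so the product over the window has entries at least `d^(-τ_b m) 2^(-(f+1)m)` in the
columns of all sources of `H` (`exists_large_columns`). There are more than `f` reduced graphs
(`lt_numReducedGraphs`), so this is at least `(2d)^(-τ_b m) ≥ β`. One such column per window already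
gives consensus (`tendsto_consensus`).

For optimality, take probability vectors with `p[t] = p[t+1] M[t]` (`exists_absoluteProbability`).
The large columns show that every `p[t]` has at least `γ` entries at least `β`, so it is a valid
weight vector. The average `z[t] = p[t] ⬝ᵥ x[t]` is unchanged by `M[t]`, and therefore behaves like
a gradient iteration for the valid functions with weights `p[t+1]`. By compactness of the valid
weights, the gradients of all valid functions have a common sign and are bounded away from zero at
each point of `X` on one side of `Y(β, γ)`. As the stepsizes are not summable, `z[t]` is driven to
`Y(β, γ)` from both sides (`IsDescent.tendsto_infDist`). This set is an interval, and consensus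
transfers the conclusion to every state. -/

namespace ByzOpt

open Matrix

/-! ### Lower bounds for products of stochastic matrices. -/

section Products

variable {W : Type*} [Fintype W] [DecidableEq W]

/-- The product `M (t + s - 1) * ⋯ * M t` of `s` consecutive matrices. -/
def stepProduct (M : ℕ → Matrix W W ℝ) (t : ℕ) : ℕ → Matrix W W ℝ
  | 0 => 1
  | s + 1 => M (t + s) * stepProduct M t s

lemma stepProduct_mem_rowStochastic {M : ℕ → Matrix W W ℝ}
    (hM : ∀ t, M t ∈ rowStochastic ℝ W) (t s : ℕ) : stepProduct M t s ∈ rowStochastic ℝ W := by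
  induction s with
  | zero => exact one_mem _
  | succ s ih => exact mul_mem (hM _) ih

/-- The vertices that can be reached from `j` along at most `k` edges of `H`. -/
noncomputable def reachWithin (H : Digraph W) (j : W) : ℕ → Finset W
  | 0 => {j}
  | k + 1 => open Classical in
      reachWithin H j k ∪ Finset.univ.filter fun i => ∃ i' ∈ reachWithin H j k, H.Adj i' i

lemma mem_reachWithin_succ {H : Digraph W} {j i : W} {k : ℕ} :
    i ∈ reachWithin H j (k + 1) ↔
      i ∈ reachWithin H j k ∨ ∃ i' ∈ reachWithin H j k, H.Adj i' i := by
  classical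
  simp [reachWithin]

lemma self_mem_reachWithin (H : Digraph W) (j : W) (k : ℕ) : j ∈ reachWithin H j k := by
  induction k with
  | zero => simp [reachWithin]
  | succ k ih => exact mem_reachWithin_succ.2 (Or.inl ih)

/-- The reached set gains a vertex in every round until it is closed under edges, and a closed set
containing a source is everything. -/
lemma reachWithin_eq_univ_or_card_lt {H : Digraph W} {j : W} (hj : j ∈ sourceComponent H) (k : ℕ) :
    reachWithin H j k = Finset.univ ∨ k < (reachWithin H j k).card := by
  induction k with
  | zero => right; simp [reachWithin]
  | succ k ih =>
    have hsub : reachWithin H j k ⊆ reachWithin H j (k + 1) :=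
      fun i hi => mem_reachWithin_succ.2 (Or.inl hi)
    rcases ih with ih | ih
    · left
      exact Finset.univ_subset_iff.1 (ih ▸ hsub)
    · by_cases heq : reachWithin H j (k + 1) ⊆ reachWithin H j k
      · left
        refine Finset.eq_univ_of_forall fun i => hsub ?_
        induction hj i with
        | refl => exact self_mem_reachWithin H j k
        | tail _ hbc hb => exact heq (mem_reachWithin_succ.2 (Or.inr ⟨_, hb, hbc⟩))
      · right
        have := Finset.card_lt_card (Finset.ssubset_iff_subset_ne.2
          ⟨hsub, fun h => heq h.ge⟩)
        omega

lemma reachWithin_card {H : Digraph W} {j : W} (hj : j ∈ sourceComponent H) :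
    reachWithin H j (Fintype.card W) = Finset.univ := by
  rcases reachWithin_eq_univ_or_card_lt hj (Fintype.card W) with h | h
  · exact h
  · exact absurd (Finset.card_le_univ _) (not_le.2 h)

/-- If all diagonal entries are at least `a`, and the entries along the edges of the graph `H t` of
step `t` are at least `a * κ`, then a product in which `H` occurs at least `k` times has large
entries at the pairs joined by at most `k` edges of `H`. -/
lemma pow_le_stepProduct {M : ℕ → Matrix W W ℝ} (hM : ∀ t, M t ∈ rowStochastic ℝ W)
    {a κ : ℝ} (ha : 0 ≤ a) (hκ : 0 ≤ κ) (hκ1 : κ ≤ 1) (hdiag : ∀ t i, a ≤ M t i i)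
    (Hs : ℕ → Digraph W) (hedge : ∀ t i j, (Hs t).Adj j i → a * κ ≤ M t i j)
    (H : Digraph W) (j : W) (t s k : ℕ) (i : W) (hi : i ∈ reachWithin H j k)
    (hk : k ≤ (open Classical in (Finset.range s).filter fun r => Hs (t + r) = H).card) :
    a ^ s * κ ^ k ≤ stepProduct M t s i j := by
  classical
  induction s generalizing k i with
  | zero =>
    obtain rfl : k = 0 := by simpa using hk
    obtain rfl : i = j := by simpa [reachWithin] using hi
    simp [stepProduct]
  | succ s ih =>
    have hP := (stepProduct_mem_rowStochastic hM t s).1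
    have key : ∀ l, M (t + s) i l * stepProduct M t s l j ≤ stepProduct M t (s + 1) i j := by
      intro l
      rw [stepProduct, Matrix.mul_apply]
      exact Finset.single_le_sum (f := fun l => M (t + s) i l * stepProduct M t s l j)
        (fun l _ => mul_nonneg ((hM _).1 _ _) (hP _ _)) (Finset.mem_univ l)
    -- Waiting at `i` costs only the diagonal factor `a`. The factor `κ` is spent only where an
    -- occurrence of `H` is used to cross an edge, so its exponent is `k` and not the number of
    -- steps.
    have stay : ∀ k, i ∈ reachWithin H j k →
        k ≤ ((Finset.range s).filter fun r => Hs (t + r) = H).card →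
        a ^ (s + 1) * κ ^ k ≤ stepProduct M t (s + 1) i j := by
      intro k hi hk
      refine le_trans ?_ (key i)
      rw [pow_succ', mul_assoc]
      exact mul_le_mul (hdiag _ _) (ih k i hi hk) (by positivity) ((hM _).1 _ _)
    rw [Finset.range_add_one, Finset.filter_insert] at hk
    split_ifs at hk with hH
    · rw [Finset.card_insert_of_notMem (by simp)] at hk
      rcases k with _ | k
      · exact stay 0 hi (Nat.zero_le _)
      · have hk' := Nat.le_of_succ_le_succ hk
        rcases mem_reachWithin_succ.1 hi with hi' | ⟨i', hi', hadj⟩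
        · refine le_trans ?_ (stay k hi' hk')
          exact mul_le_mul_of_nonneg_left (pow_le_pow_of_le_one hκ hκ1 (Nat.le_succ k))
            (by positivity)
        · refine le_trans ?_ (key i')
          calc a ^ (s + 1) * κ ^ (k + 1) = (a * κ) * (a ^ s * κ ^ k) := by ring
            _ ≤ _ := mul_le_mul (hedge _ _ _ (hH ▸ hadj)) (ih k i' hi' hk') (by positivity)
              ((hM _).1 _ _)
    · exact stay k hi hk

/-- In every window of length `T.card * card W`, where `T` is a finite set of graphs containing all
`Hs t`, some graph of `T` gives large columns at all elements of its source component. -/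
lemma exists_large_columns {M : ℕ → Matrix W W ℝ} (hM : ∀ t, M t ∈ rowStochastic ℝ W)
    {a κ : ℝ} (ha : 0 ≤ a) (hκ : 0 ≤ κ) (hκ1 : κ ≤ 1) (hdiag : ∀ t i, a ≤ M t i i)
    (Hs : ℕ → Digraph W) (hedge : ∀ t i j, (Hs t).Adj j i → a * κ ≤ M t i j)
    (T : Finset (Digraph W)) (hT : ∀ t, Hs t ∈ T) (t : ℕ) :
    ∃ H ∈ T, ∀ j ∈ sourceComponent H, ∀ i,
      a ^ (T.card * Fintype.card W) * κ ^ Fintype.card W ≤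
        stepProduct M t (T.card * Fintype.card W) i j := by
  classical
  -- Pigeonhole: the steps of the window are distributed over `T.card` graphs, so one graph receives
  -- at least `card W` of them.
  obtain ⟨H, hH, hcard⟩ := Finset.exists_le_card_fiber_of_mul_le_card_of_maps_to
    (s := Finset.range (T.card * Fintype.card W)) (t := T) (f := fun r => Hs (t + r))
    (n := Fintype.card W) (fun r _ => hT _) ⟨_, hT 0⟩ (by simp)
  refine ⟨H, hH, fun j hj i => ?_⟩
  exact pow_le_stepProduct hM ha hκ hκ1 hdiag Hs hedge H j t _ _ i
    (by rw [reachWithin_card hj]; exact Finset.mem_univ i) (by convert hcard)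

end Products

/-! ### Absolute probability sequences. -/

section AbsoluteProbability

variable {W : Type*} [Fintype W] [DecidableEq W]

lemma vecMul_mem_stdSimplex {M : Matrix W W ℝ} (hM : M ∈ rowStochastic ℝ W) {p : W → ℝ}
    (hp : p ∈ stdSimplex ℝ W) : p ᵥ* M ∈ stdSimplex ℝ W := by
  refine ⟨nonneg_vecMul_of_mem_rowStochastic hM hp.1, ?_⟩
  have := vecMul_dotProduct_one_eq_one_rowStochastic hM (x := p) (by simpa [dotProduct] using hp.2)
  simpa [dotProduct] using this

/-- Every sequence of row stochastic matrices has a sequence of absolute probabilities. -/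
lemma exists_absoluteProbability [Nonempty W] {M : ℕ → Matrix W W ℝ}
    (hM : ∀ t, M t ∈ rowStochastic ℝ W) :
    ∃ p : ℕ → W → ℝ, (∀ t, p t ∈ stdSimplex ℝ W) ∧ ∀ t, p t = p (t + 1) ᵥ* M t := by
  -- Compactness: the sequences satisfying the recursion before time `T` form a decreasing family of
  -- nonempty closed subsets of a product of simplices. A member is built by fixing a vector at time
  -- `T` and multiplying backwards.
  let A : ℕ → Set (ℕ → W → ℝ) := fun T =>
    (Set.univ.pi fun _ => stdSimplex ℝ W) ∩ {p | ∀ t < T, p t = p (t + 1) ᵥ* M t}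
  have hcompact : IsCompact (Set.univ.pi fun _ : ℕ => stdSimplex ℝ W) :=
    isCompact_univ_pi fun _ => isCompact_stdSimplex ℝ W
  have hclosed : ∀ T, IsClosed (A T) := by
    intro T
    refine hcompact.isClosed.inter ?_
    simp only [Set.ofPred_forall]
    refine isClosed_iInter fun t => isClosed_iInter fun _ => isClosed_eq (by fun_prop) ?_
    exact Continuous.matrix_vecMul (by fun_prop) continuous_const
  have hne : ∀ T, (A T).Nonempty := by
    intro T
    obtain ⟨p₀, hp₀⟩ : (stdSimplex ℝ W).Nonempty :=
      ⟨_, single_mem_stdSimplex ℝ (Classical.arbitrary W)⟩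
    let q : ℕ → W → ℝ := fun k => Nat.rec p₀ (fun k r => r ᵥ* M (T - 1 - k)) k
    have hq : ∀ k, q k ∈ stdSimplex ℝ W := by
      intro k
      induction k with
      | zero => exact hp₀
      | succ k ih => exact vecMul_mem_stdSimplex (hM _) ih
    refine ⟨fun t => q (T - t), fun t _ => hq _, fun t ht => ?_⟩
    have h1 : T - t = (T - (t + 1)) + 1 := by omega
    have h2 : T - 1 - (T - (t + 1)) = t := by omega
    change q (T - t) = q (T - (t + 1)) ᵥ* M t
    rw [h1]
    change q (T - (t + 1)) ᵥ* M (T - 1 - (T - (t + 1))) = _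
    rw [h2]
  obtain ⟨p, hp⟩ := IsCompact.nonempty_iInter_of_sequence_nonempty_isCompact_isClosed A
    (fun T p hp => ⟨hp.1, fun t ht => hp.2 t (ht.trans (Nat.lt_succ_self T))⟩) hne
    (hcompact.of_isClosed_subset (hclosed 0) Set.inter_subset_left) hclosed
  rw [Set.mem_iInter] at hp
  exact ⟨p, fun t => (hp 0).1 t (Set.mem_univ t), fun t => (hp (t + 1)).2 t (Nat.lt_succ_self t)⟩

lemma absoluteProbability_eq_vecMul_stepProduct {M : ℕ → Matrix W W ℝ} {p : ℕ → W → ℝ}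
    (hpM : ∀ t, p t = p (t + 1) ᵥ* M t) (t s : ℕ) : p t = p (t + s) ᵥ* stepProduct M t s := by
  induction s with
  | zero => simp [stepProduct]
  | succ s ih =>
    rw [ih, stepProduct, ← Matrix.vecMul_vecMul]
    congr 1
    exact hpM (t + s)

/-- The entry `p t j` is an average of column `j` of the product, with weights `p (t + s)`. -/
lemma le_absoluteProbability {M : ℕ → Matrix W W ℝ} {p : ℕ → W → ℝ}
    (hp : ∀ t, p t ∈ stdSimplex ℝ W) (hpM : ∀ t, p t = p (t + 1) ᵥ* M t) {t s : ℕ} {δ : ℝ} {j : W}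
    (hj : ∀ i, δ ≤ stepProduct M t s i j) : δ ≤ p t j := by
  rw [absoluteProbability_eq_vecMul_stepProduct hpM t s]
  calc δ = ∑ i, p (t + s) i * δ := by rw [← Finset.sum_mul, (hp _).2, one_mul]
    _ ≤ ∑ i, p (t + s) i * stepProduct M t s i j :=
      Finset.sum_le_sum fun i _ => mul_le_mul_of_nonneg_left (hj i) ((hp _).1 i)

end AbsoluteProbability

/-! ### Consensus under vanishing perturbations. -/

section Consensus

/-- Along each residue class modulo `ν`, once `b` is below `ε / 2 * (1 - ρ)`, the recursion has
fixed point at most `ε / 2` and the excess decays like `ρ ^ k`. -/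
lemma tendsto_zero_of_contraction {a b : ℕ → ℝ} {ρ : ℝ} {ν : ℕ} (hν : 0 < ν) (hρ0 : 0 ≤ ρ)
    (hρ1 : ρ < 1) (ha : ∀ t, 0 ≤ a t) (hab : ∀ t, a (t + ν) ≤ ρ * a t + b t)
    (hb : Tendsto b atTop (𝓝 0)) : Tendsto a atTop (𝓝 0) := by
  rw [Metric.tendsto_atTop]
  intro ε hε
  have hpos : 0 < ε / 2 * (1 - ρ) := by
    have : 0 < 1 - ρ := by linarith
    positivity
  obtain ⟨T, hT⟩ := eventually_atTop.1 (hb.eventually_lt_const hpos)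
  obtain ⟨C, hC⟩ : ∃ C : ℝ, 0 ≤ C ∧ ∀ r < ν, a (T + r) ≤ C := by
    refine ⟨∑ r ∈ Finset.range ν, a (T + r), Finset.sum_nonneg fun r _ => ha _, fun r hr => ?_⟩
    exact Finset.single_le_sum (f := fun r => a (T + r)) (fun r _ => ha _) (Finset.mem_range.2 hr)
  have key : ∀ k, ∀ r < ν, a (T + r + k * ν) ≤ ε / 2 + ρ ^ k * C := by
    intro k r hr
    induction k with
    | zero => simpa using (hC.2 r hr).trans (by linarith)
    | succ k ih =>
      have h1 := hab (T + r + k * ν)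
      have h2 := hT (T + r + k * ν) (by omega)
      have h3 := mul_le_mul_of_nonneg_left ih hρ0
      have h4 : T + r + (k + 1) * ν = T + r + k * ν + ν := by ring
      rw [h4, pow_succ']
      linarith
  have hlim : Tendsto (fun k : ℕ => ρ ^ k * C) atTop (𝓝 0) := by
    simpa using (tendsto_pow_atTop_nhds_zero_of_lt_one hρ0 hρ1).mul_const C
  obtain ⟨k₀, hk₀⟩ := eventually_atTop.1 (hlim.eventually_lt_const (half_pos hε))
  refine ⟨T + k₀ * ν, fun t ht => ?_⟩
  have hdiv : k₀ ≤ (t - T) / ν := (Nat.le_div_iff_mul_le hν).2 (by omega)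
  have heq : T + (t - T) % ν + (t - T) / ν * ν = t := by
    have := Nat.mod_add_div' (t - T) ν
    have hle : T ≤ t := le_trans (Nat.le_add_right _ _) ht
    omega
  have h1 := key ((t - T) / ν) ((t - T) % ν) (Nat.mod_lt _ hν)
  rw [heq] at h1
  have h2 := hk₀ _ hdiv
  rw [Real.dist_eq, sub_zero, abs_of_nonneg (ha t)]
  linarith

variable {W : Type*} [Fintype W] [DecidableEq W]

lemma mulVec_le_of_le {P : Matrix W W ℝ} (hP : P ∈ rowStochastic ℝ W) {y : W → ℝ} {c : ℝ}
    (hy : ∀ i, y i ≤ c) (i : W) : (P *ᵥ y) i ≤ c := by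
  calc (P *ᵥ y) i = ∑ l, P i l * y l := rfl
    _ ≤ ∑ l, P i l * c := Finset.sum_le_sum fun l _ => mul_le_mul_of_nonneg_left (hy l) (hP.1 _ _)
    _ = c := by rw [← Finset.sum_mul, sum_row_of_mem_rowStochastic hP, one_mul]

lemma le_mulVec_of_le {P : Matrix W W ℝ} (hP : P ∈ rowStochastic ℝ W) {y : W → ℝ} {c : ℝ}
    (hy : ∀ i, c ≤ y i) (i : W) : c ≤ (P *ᵥ y) i := by
  have := mulVec_le_of_le hP (y := -y) (c := -c) (fun i => neg_le_neg (hy i)) i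
  rw [Matrix.mulVec_neg] at this
  exact neg_le_neg_iff.1 this

lemma mulVec_le_of_column {P : Matrix W W ℝ} (hP : P ∈ rowStochastic ℝ W) {δ : ℝ} {j : W}
    (hj : ∀ i, δ ≤ P i j) {y : W → ℝ} {c : ℝ} (hy : ∀ i, y i ≤ c) (i : W) :
    (P *ᵥ y) i ≤ δ * y j + (1 - δ) * c := by
  have h1 : (P *ᵥ y) i = c - ∑ l, P i l * (c - y l) := by
    have : (P *ᵥ y) i = ∑ l, P i l * y l := rfl
    rw [this]
    simp only [mul_sub, Finset.sum_sub_distrib]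
    rw [← Finset.sum_mul, sum_row_of_mem_rowStochastic hP]
    ring
  have h2 : P i j * (c - y j) ≤ ∑ l, P i l * (c - y l) :=
    Finset.single_le_sum (f := fun l => P i l * (c - y l))
      (fun l _ => mul_nonneg (hP.1 _ _) (sub_nonneg.2 (hy l))) (Finset.mem_univ j)
  have h3 := mul_le_mul_of_nonneg_right (hj i) (sub_nonneg.2 (hy j))
  rw [h1]
  linarith

lemma le_mulVec_of_column {P : Matrix W W ℝ} (hP : P ∈ rowStochastic ℝ W) {δ : ℝ} {j : W}
    (hj : ∀ i, δ ≤ P i j) {y : W → ℝ} {c : ℝ} (hy : ∀ i, c ≤ y i) (i : W) :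
    δ * y j + (1 - δ) * c ≤ (P *ᵥ y) i := by
  have := mulVec_le_of_column hP hj (y := -y) (c := -c) (fun i => neg_le_neg (hy i)) i
  rw [Matrix.mulVec_neg] at this
  simp only [Pi.neg_apply] at this
  linarith

/-- Averaging does not enlarge the sup norm, so the errors of single steps merely add up. -/
lemma abs_sub_stepProduct_mulVec_le {M : ℕ → Matrix W W ℝ} (hM : ∀ t, M t ∈ rowStochastic ℝ W)
    {x : ℕ → W → ℝ} {η : ℕ → ℝ} (hx : ∀ t i, |x (t + 1) i - (M t *ᵥ x t) i| ≤ η t) (t s : ℕ)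
    (i : W) : |x (t + s) i - (stepProduct M t s *ᵥ x t) i| ≤ ∑ r ∈ Finset.range s, η (t + r) := by
  induction s generalizing i with
  | zero => simp [stepProduct]
  | succ s ih =>
    rw [Finset.sum_range_succ, stepProduct, ← Matrix.mulVec_mulVec]
    set y := stepProduct M t s *ᵥ x t with hy
    set E := ∑ r ∈ Finset.range s, η (t + r)
    have h1 : (M (t + s) *ᵥ (x (t + s) - y)) i ≤ E :=
      mulVec_le_of_le (hM _) (fun l => (abs_le.1 (ih l)).2) i
    have h2 : -E ≤ (M (t + s) *ᵥ (x (t + s) - y)) i :=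
      le_mulVec_of_le (hM _) (fun l => (abs_le.1 (ih l)).1) i
    rw [Matrix.mulVec_sub, Pi.sub_apply] at h1 h2
    have h3 := abs_le.1 (hx (t + s) i)
    rw [← add_assoc]
    exact abs_le.2 ⟨by linarith [h3.1], by linarith [h3.2]⟩

/-- Perturbed averaging with vanishing perturbations leads to consensus, provided that all
products over windows of a fixed length have a column bounded away from zero. -/
lemma tendsto_consensus [Nonempty W] {M : ℕ → Matrix W W ℝ} (hM : ∀ t, M t ∈ rowStochastic ℝ W)
    {x : ℕ → W → ℝ} {η : ℕ → ℝ} (hx : ∀ t i, |x (t + 1) i - (M t *ᵥ x t) i| ≤ η t)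
    (hη : Tendsto η atTop (𝓝 0)) {ν : ℕ} (hν : 0 < ν) {δ : ℝ} (hδ : 0 < δ)
    (hcol : ∀ t, ∃ j, ∀ i, δ ≤ stepProduct M t ν i j) (i k : W) :
    Tendsto (fun t => |x t i - x t k|) atTop (𝓝 0) := by
  let hi : ℕ → ℝ := fun t => Finset.univ.sup' Finset.univ_nonempty (x t)
  let lo : ℕ → ℝ := fun t => Finset.univ.inf' Finset.univ_nonempty (x t)
  have hhi : ∀ t i, x t i ≤ hi t := fun t i => Finset.le_sup' (x t) (Finset.mem_univ i)
  have hlo : ∀ t i, lo t ≤ x t i := fun t i => Finset.inf'_le (x t) (Finset.mem_univ i)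
  have hδ1 : δ ≤ 1 := by
    obtain ⟨j, hj⟩ := hcol 0
    exact (hj j).trans (le_one_of_mem_rowStochastic (stepProduct_mem_rowStochastic hM 0 ν))
  have hD : Tendsto (fun t => hi t - lo t) atTop (𝓝 0) := by
    -- All rows put weight at least `δ` on the same `j`, which pulls maximum and minimum towards `x
    -- t j`. The spread shrinks by the factor `1 - δ`, up to twice the accumulated error.
    refine tendsto_zero_of_contraction (ρ := 1 - δ)
      (b := fun t => 2 * ∑ r ∈ Finset.range ν, η (t + r)) hν (by linarith) (by linarith)
      (fun t => sub_nonneg.2 ((hlo t i).trans (hhi t i))) (fun t => ?_) ?_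
    · obtain ⟨j, hj⟩ := hcol t
      have hP := stepProduct_mem_rowStochastic hM t ν
      have h1 : hi (t + ν) ≤ δ * x t j + (1 - δ) * hi t + ∑ r ∈ Finset.range ν, η (t + r) :=
        Finset.sup'_le _ _ fun l _ => by
          have h2 := abs_le.1 (abs_sub_stepProduct_mulVec_le hM hx t ν l)
          have h3 := mulVec_le_of_column hP hj (hhi t) l
          linarith [h2.2]
      have h1' : δ * x t j + (1 - δ) * lo t - ∑ r ∈ Finset.range ν, η (t + r) ≤ lo (t + ν) :=
        Finset.le_inf' _ _ fun l _ => by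
          have h2 := abs_le.1 (abs_sub_stepProduct_mulVec_le hM hx t ν l)
          have h3 := le_mulVec_of_column hP hj (hlo t) l
          linarith [h2.1]
      linarith
    · have h : Tendsto (fun t => ∑ r ∈ Finset.range ν, η (t + r)) atTop
          (𝓝 (∑ _r ∈ Finset.range ν, (0 : ℝ))) :=
        tendsto_finsetSum _ fun r _ => hη.comp (tendsto_add_atTop_nat r)
      simpa using h.const_mul 2
  refine squeeze_zero (fun t => abs_nonneg _) (fun t => ?_) hD
  exact abs_le.2 ⟨by linarith [hlo t i, hhi t k], by linarith [hlo t k, hhi t i]⟩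

end Consensus

/-! ### Trimmed sums as combinations of honest values. -/

section Trimming

variable {V : Type*} [DecidableEq V]

lemma four_mul_le_two_pow_succ {f : ℕ} (hf : 1 ≤ f) : 4 * f ≤ 2 ^ (f + 1) := by
  induction f, hf using Nat.le_induction with
  | base => norm_num
  | succ f hf ih => rw [pow_succ]; omega

lemma IsTrimming.card_add {N : Finset V} {w : V → ℝ} {f : ℕ} {K : Finset V}
    (hK : IsTrimming N w f K) : K.card + 2 * f = N.card := by
  obtain ⟨S, B, hS, hB, hSB, hSc, hBc, -, -, rfl⟩ := hK
  have h1 := Finset.card_sdiff_add_card_eq_card (Finset.union_subset hS hB)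
  rw [Finset.card_union_of_disjoint hSB] at h1
  omega

/-- The values that survive the trimming average to a nonnegative combination of the values of the
honest senders in which all but at most `f` of them have a substantial weight. -/
lemma IsTrimming.exists_weights {N F K : Finset V} {w : V → ℝ} {f : ℕ} (hF : F.card ≤ f)
    (hN : 0 < f → 2 * f + 1 ≤ N.card) (hK : IsTrimming N w f K) :
    ∃ c : V → ℝ, (∀ j, 0 ≤ c j) ∧ ∑ j ∈ K, w j = ∑ j ∈ N \ F, c j * w j ∧
      ∑ j ∈ N \ F, c j = K.card ∧
      ∃ E : Finset V, E.card ≤ f ∧ ∀ j ∈ N \ F, j ∉ E → (1 / 2) ^ (f + 1) ≤ c j := by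
  have hKcard := hK.card_add
  obtain ⟨S, B, hS, hB, hSB, hSc, hBc, hSmall, hBig, rfl⟩ := hK
  have hle1 : ((1 : ℝ) / 2) ^ (f + 1) ≤ 1 / 2 := by
    rw [pow_succ]
    have : ((1 : ℝ) / 2) ^ f ≤ 1 := pow_le_one₀ (by norm_num) (by norm_num)
    linarith
  -- the case in which all faulty senders have been discarded on one side
  have easy : ∀ E : Finset V, E.card = f → F ⊆ S ∪ B → (S ∪ B) \ F ⊆ E →
      ∃ c : V → ℝ, (∀ j, 0 ≤ c j) ∧ ∑ j ∈ N \ (S ∪ B), w j = ∑ j ∈ N \ F, c j * w j ∧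
      ∑ j ∈ N \ F, c j = (N \ (S ∪ B)).card ∧
      ∃ E : Finset V, E.card ≤ f ∧ ∀ j ∈ N \ F, j ∉ E → (1 / 2) ^ (f + 1) ≤ c j := by
    intro E hE hFsub hsub
    have hsubset : N \ (S ∪ B) ⊆ N \ F := Finset.sdiff_subset_sdiff le_rfl hFsub
    refine ⟨fun j => if j ∈ N \ (S ∪ B) then 1 else 0, fun j => by dsimp only; split_ifs <;> norm_num, ?_, ?_,
      E, hE.le, fun j hj hjE => ?_⟩
    · simp only [ite_mul, one_mul, zero_mul]
      rw [← Finset.sum_filter, Finset.filter_mem_eq_inter, Finset.inter_eq_right.2 hsubset]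
    · rw [← Finset.sum_filter, Finset.filter_mem_eq_inter, Finset.inter_eq_right.2 hsubset]
      simp
    · have : j ∈ N \ (S ∪ B) := by
        rw [Finset.mem_sdiff] at hj ⊢
        exact ⟨hj.1, fun h => hjE (hsub (Finset.mem_sdiff.2 ⟨h, hj.2⟩))⟩
      simp only [this, if_true]
      linarith
  rcases (S \ F).eq_empty_or_nonempty with hSF | hSF
  -- `S` has `f ≥ |F|` elements. Without an honest element it equals `F`, hence all survivors are
  -- honest and only the senders in `B` may lose their weight.
  · have hSeq : S = F := Finset.eq_of_subset_of_card_le (Finset.sdiff_eq_empty_iff_subset.1 hSF)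
      (by omega)
    exact easy B hBc (hSeq ▸ Finset.subset_union_left) (by
      rw [hSeq]; intro j hj; simp only [Finset.mem_sdiff, Finset.mem_union] at hj; tauto)
  rcases (B \ F).eq_empty_or_nonempty with hBF | hBF
  · have hBeq : B = F := Finset.eq_of_subset_of_card_le (Finset.sdiff_eq_empty_iff_subset.1 hBF)
      (by omega)
    exact easy S hSc (hBeq ▸ Finset.subset_union_right) (by
      rw [hBeq]; intro j hj; simp only [Finset.mem_sdiff, Finset.mem_union] at hj; tauto)
  -- the general case
  have hScard : (S \ F).card ≤ f := hSc ▸ Finset.card_le_card Finset.sdiff_subset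
  have hBcard : (B \ F).card ≤ f := hBc ▸ Finset.card_le_card Finset.sdiff_subset
  have hf : 0 < f := lt_of_lt_of_le (Finset.card_pos.2 hSF) hScard
  have hKpos : 1 ≤ (N \ (S ∪ B)).card := by have := hN hf; omega
  set K := N \ (S ∪ B) with hKdef
  have hsp : (0 : ℝ) < (S \ F).card := by exact_mod_cast Finset.card_pos.2 hSF
  have hbp : (0 : ℝ) < (B \ F).card := by exact_mod_cast Finset.card_pos.2 hBF
  set sbar : ℝ := (∑ j ∈ S \ F, w j) / (S \ F).card with hsbar
  set bbar : ℝ := (∑ j ∈ B \ F, w j) / (B \ F).card with hbbar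
  have hsk : ∀ k ∈ K, sbar ≤ w k := by
    intro k hk
    rw [hsbar, div_le_iff₀ hsp, mul_comm, ← nsmul_eq_mul]
    refine Finset.sum_le_card_nsmul _ _ _ fun s hs => hSmall s (Finset.mem_sdiff.1 hs).1 k ?_
    simp only [hKdef, Finset.mem_sdiff, Finset.mem_union, not_or] at hk ⊢
    exact ⟨hk.1, hk.2.1⟩
  have hbk : ∀ k ∈ K, w k ≤ bbar := by
    intro k hk
    rw [hbbar, le_div_iff₀ hbp, mul_comm, ← nsmul_eq_mul]
    refine Finset.card_nsmul_le_sum _ _ _ fun b hb => hBig b (Finset.mem_sdiff.1 hb).1 k ?_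
    simp only [hKdef, Finset.mem_sdiff, Finset.mem_union, not_or] at hk ⊢
    exact ⟨hk.1, hk.2.2⟩
  -- `g k` is the share of a survivor's unit weight passed to the discarded honest senders, which is
  -- possible because `w k` lies between their means `sbar` and `bbar`. A faulty survivor passes
  -- everything, an honest one keeps half.
  let g : V → ℝ := fun k => if k ∈ F then 1 else 1 / 2
  have hg : ∀ k, 1 / 2 ≤ g k := fun k => by simp only [g]; split_ifs <;> norm_num
  have hgpos : ∀ k, 0 ≤ g k := fun k => le_trans (by norm_num) (hg k)
  obtain ⟨A, B', hA, hB', hAB, hABsum⟩ : ∃ A B' : ℝ, 0 ≤ A ∧ 0 ≤ B' ∧ A + B' = ∑ k ∈ K, g k ∧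
      A * sbar + B' * bbar = ∑ k ∈ K, g k * w k := by
    have hθ : ∀ k ∈ K, ∃ p : ℝ × ℝ, 0 ≤ p.1 ∧ 0 ≤ p.2 ∧ p.1 + p.2 = 1 ∧
        p.1 * sbar + p.2 * bbar = w k := by
      intro k hk
      have : w k ∈ segment ℝ sbar bbar := by
        rw [segment_eq_Icc ((hsk k hk).trans (hbk k hk))]
        exact ⟨hsk k hk, hbk k hk⟩
      obtain ⟨a, b, ha, hb, hab, h⟩ := this
      exact ⟨(a, b), ha, hb, hab, by simpa using h⟩
    choose! p hp1 hp2 hp3 hp4 using hθ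
    refine ⟨∑ k ∈ K, g k * (p k).1, ∑ k ∈ K, g k * (p k).2,
      Finset.sum_nonneg fun k hk => mul_nonneg (hgpos k) (hp1 k hk),
      Finset.sum_nonneg fun k hk => mul_nonneg (hgpos k) (hp2 k hk), ?_, ?_⟩
    · rw [← Finset.sum_add_distrib]
      exact Finset.sum_congr rfl fun k hk => by rw [← mul_add, hp3 k hk, mul_one]
    · rw [Finset.sum_mul, Finset.sum_mul, ← Finset.sum_add_distrib]
      exact Finset.sum_congr rfl fun k hk => by rw [← hp4 k hk]; ring
  have hmass : 1 / 2 ≤ A + B' := by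
    obtain ⟨k, hk⟩ := Finset.card_pos.1 hKpos
    rw [hAB]
    exact (hg k).trans (Finset.single_le_sum (fun k _ => hgpos k) hk)
  have hlarge : ∀ (D : ℝ) (n : ℕ), 1 / 4 ≤ D → (0 : ℝ) < n → n ≤ f →
      ((1 : ℝ) / 2) ^ (f + 1) ≤ D / n := by
    intro D n hD hn hnf
    rw [le_div_iff₀ hn]
    have h1 : (4 * f : ℝ) ≤ 2 ^ (f + 1) := by exact_mod_cast four_mul_le_two_pow_succ hf
    have h2 : ((1 : ℝ) / 2) ^ (f + 1) * 2 ^ (f + 1) = 1 := by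
      rw [← mul_pow]; norm_num
    have h3 : (n : ℝ) ≤ f := by exact_mod_cast hnf
    have h4 : (0 : ℝ) < (1 / 2) ^ (f + 1) := by positivity
    nlinarith
  -- the sum over the honest senders splits into three parts
  have hdisj1 : Disjoint (K \ F) (S \ F) := by
    rw [Finset.disjoint_left]; intro j; simp only [hKdef, Finset.mem_sdiff, Finset.mem_union]; tauto
  have hdisj2 : Disjoint ((K \ F) ∪ (S \ F)) (B \ F) := by
    rw [Finset.disjoint_left] at hSB ⊢
    intro j hj hj'
    have := @hSB j
    simp only [hKdef, Finset.mem_sdiff, Finset.mem_union] at hj hj'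
    tauto
  have hunion : N \ F = (K \ F) ∪ (S \ F) ∪ (B \ F) := by
    ext j
    have h1 := @hS j
    have h2 := @hB j
    simp only [hKdef, Finset.mem_sdiff, Finset.mem_union]
    tauto
  let c : V → ℝ := fun j =>
    if j ∈ S then A / (S \ F).card else if j ∈ B then B' / (B \ F).card else 1 / 2
  have hcS : ∀ j ∈ S \ F, c j = A / (S \ F).card := fun j hj => by
    simp [c, (Finset.mem_sdiff.1 hj).1]
  have hcB : ∀ j ∈ B \ F, c j = B' / (B \ F).card := fun j hj => by
    have hjB := (Finset.mem_sdiff.1 hj).1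
    simp [c, hjB, Finset.disjoint_right.1 hSB hjB]
  have hcK : ∀ j ∈ K \ F, c j = 1 / 2 := fun j hj => by
    simp only [hKdef, Finset.mem_sdiff, Finset.mem_union, not_or] at hj
    simp [c, hj.1.2.1, hj.1.2.2]
  have hsplit : ∀ u : V → ℝ, ∑ j ∈ K, u j = ∑ j ∈ K, g j * u j + ∑ j ∈ K \ F, 1 / 2 * u j := by
    intro u
    have h0 : ∑ j ∈ K \ F, 1 / 2 * u j = ∑ j ∈ K, (if j ∈ F then 0 else 1 / 2) * u j := by
      rw [Finset.sdiff_eq_filter, Finset.sum_filter]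
      exact Finset.sum_congr rfl fun j _ => by split_ifs <;> simp_all
    rw [h0, ← Finset.sum_add_distrib]
    refine Finset.sum_congr rfl fun j _ => ?_
    simp only [g]
    split_ifs <;> ring
  refine ⟨c, fun j => ?_, ?_, ?_, ?_⟩
  · simp only [c]
    split_ifs
    exacts [div_nonneg hA hsp.le, div_nonneg hB' hbp.le, by norm_num]
  · have hK' : ∑ j ∈ K \ F, c j * w j = ∑ j ∈ K \ F, 1 / 2 * w j :=
      Finset.sum_congr rfl fun j hj => by rw [hcK j hj]
    have hS' : ∑ j ∈ S \ F, c j * w j = A * sbar := by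
      rw [Finset.sum_congr rfl fun j hj => by rw [hcS j hj], ← Finset.mul_sum, hsbar]
      ring
    have hB'' : ∑ j ∈ B \ F, c j * w j = B' * bbar := by
      rw [Finset.sum_congr rfl fun j hj => by rw [hcB j hj], ← Finset.mul_sum, hbbar]
      ring
    rw [hunion, Finset.sum_union hdisj2, Finset.sum_union hdisj1, hsplit, ← hABsum, hK', hS', hB'']
    ring
  · have hone := hsplit fun _ => 1
    simp only [mul_one, Finset.sum_const, nsmul_eq_mul] at hone
    rw [hunion, Finset.sum_union hdisj2, Finset.sum_union hdisj1, hone, ← hAB,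
      Finset.sum_congr rfl hcK, Finset.sum_congr rfl hcS, Finset.sum_congr rfl hcB]
    simp only [Finset.sum_const, nsmul_eq_mul]
    rw [mul_div_cancel₀ _ hsp.ne', mul_div_cancel₀ _ hbp.ne']
    ring
  -- As `A + B' ≥ 1/2`, one side receives mass at least `1/4`. Spread over at most `f` senders this
  -- leaves each at least `1/(4f) ≥ 2^-(f+1)`. The honest senders of the other side form the
  -- exceptional set.
  · rcases le_or_gt (1 / 4) A with hA4 | hA4
    · refine ⟨B \ F, hBcard, fun j hj hjE => ?_⟩
      rw [hunion, Finset.mem_union, Finset.mem_union] at hj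
      rcases hj with (hj | hj) | hj
      · rw [hcK j hj]; exact hle1
      · rw [hcS j hj]; exact hlarge _ _ hA4 hsp hScard
      · exact absurd hj hjE
    · refine ⟨S \ F, hScard, fun j hj hjE => ?_⟩
      rw [hunion, Finset.mem_union, Finset.mem_union] at hj
      rcases hj with (hj | hj) | hj
      · rw [hcK j hj]; exact hle1
      · exact absurd hj hjE
      · rw [hcB j hj]; exact hlarge _ _ (by linarith) hbp hBcard

end Trimming

/-! ### Reduced graphs: degrees and counting. -/

section Graphs

lemma mem_inNbrs {V : Type*} [Fintype V] {G : Digraph V} {i j : V} : j ∈ inNbrs G i ↔ G.Adj j i := by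
  classical
  simp [inNbrs]

lemma ncard_subtype_le {V : Type*} {F : Finset V} (A : Set {v : V // v ∉ F}) (E : Finset V)
    (h : ∀ i ∈ A, (i : V) ∈ E) : A.ncard ≤ E.card := by
  rw [← Set.ncard_coe_finset E, ← Set.ncard_image_of_injective A Subtype.val_injective]
  refine Set.ncard_le_ncard ?_ E.finite_toSet
  rintro _ ⟨i, hi, rfl⟩
  exact h i hi

variable {V : Type*} [Fintype V] [DecidableEq V]

/-- If every reduced graph has a source component, no agent has exactly `2 * f` incoming
neighbours. -/
lemma inDegree_ne_two_mul {G : Digraph V} (hloop : ∀ v, ¬ G.Adj v v) {f : ℕ} (hf : 0 < f)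
    (hG : ∀ F' : Finset V, F'.card ≤ f → ∀ H, IsReducedGraph G f F' H →
      (sourceComponent H).Nonempty) (i : V) : inDegree G i ≠ 2 * f := by
  intro hdeg
  rw [inDegree] at hdeg
  obtain ⟨A, hAsub, hAcard⟩ := Finset.exists_subset_card_eq (s := inNbrs G i) (n := f) (by omega)
  have hrest : (inNbrs G i \ A).card = f := by
    rw [Finset.card_sdiff_of_subset hAsub]; omega
  have hi : i ∉ A := fun h => hloop i (mem_inNbrs.1 (hAsub h))
  -- With half of the `2 * f` neighbours of `i` declared faulty, the other half can be cut off from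
  -- `i`, and each other agent loses at most its edge from `i`. Then `i` is isolated but not alone,
  -- so no vertex is a source.
  let H : Digraph {v : V // v ∉ A} := ⟨fun u v => G.Adj u v ∧ (u : V) ≠ i ∧ (v : V) ≠ i⟩
  have hH : IsReducedGraph G f A H := by
    refine ⟨fun u v h => h.1, fun v => ?_⟩
    by_cases hv : (v : V) = i
    · rw [← hrest]
      refine ncard_subtype_le _ _ fun u hu => ?_
      exact Finset.mem_sdiff.2 ⟨mem_inNbrs.2 (hv ▸ hu.1), u.2⟩
    · refine (ncard_subtype_le _ {i} fun u hu => ?_).trans (by simpa using Nat.succ_le_of_lt hf)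
      by_contra hne
      exact hu.2 ⟨hu.1, by simpa using hne, hv⟩
  obtain ⟨s, hs⟩ := hG A hAcard.le H hH
  obtain ⟨u, hu⟩ : (inNbrs G i \ A).Nonempty := Finset.card_pos.1 (by omega)
  rw [Finset.mem_sdiff, mem_inNbrs] at hu
  have hsi : s = ⟨i, hi⟩ := by
    rcases Relation.ReflTransGen.cases_tail (hs ⟨i, hi⟩) with h | ⟨v, -, hv⟩
    · exact h.symm
    · exact absurd rfl hv.2.2
  rcases Relation.ReflTransGen.cases_head (hs ⟨u, hu.2⟩) with h | ⟨v, hv, -⟩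
  · have : i = u := by simpa [hsi] using congrArg Subtype.val h
    exact hloop i (by rw [← this] at hu; exact hu.1)
  · exact hv.2.1 (by rw [hsi])

lemma finite_setOf_isReducedGraph (G : Digraph V) (f : ℕ) (F : Finset V) :
    {H : Digraph {v : V // v ∉ F} | IsReducedGraph G f F H}.Finite := by
  classical
  exact Set.toFinite _

/-- If some non-faulty agent has at least `f` non-faulty incoming neighbours, there are more than
`f` reduced graphs. -/
lemma lt_numReducedGraphs {G : Digraph V} {f : ℕ} {F : Finset V} (hF : F.card ≤ f)
    {i : V} (hi : i ∉ F) (hdeg : 2 * f ≤ inDegree G i) : f < numReducedGraphs G f F := by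
  have hcard : f ≤ (inNbrs G i \ F).card := by
    have := Finset.le_card_sdiff F (inNbrs G i)
    rw [inDegree] at hdeg
    omega
  obtain ⟨T₀, hT₀, hT₀card⟩ := Finset.exists_subset_card_eq hcard
  -- Each subset of `f` honest in-neighbours of `i` may be cut off from `i`, which gives `2 ^ f > f`
  -- different reduced graphs.
  let Φ : Finset V → Digraph {v : V // v ∉ F} := fun T =>
    ⟨fun u v => G.Adj u v ∧ ¬ ((v : V) = i ∧ (u : V) ∈ T)⟩
  have hmaps : ∀ T ∈ (T₀.powerset : Set (Finset V)),
      Φ T ∈ {H : Digraph {v : V // v ∉ F} | IsReducedGraph G f F H} := by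
    intro T hT
    have hT : T ⊆ T₀ := by simpa using hT
    refine ⟨fun u v h => h.1, fun v => ?_⟩
    refine (ncard_subtype_le _ T fun u hu => ?_).trans (hT₀card ▸ Finset.card_le_card hT)
    by_contra hne
    exact hu.2 ⟨hu.1, fun h => hne h.2⟩
  have hinj : Set.InjOn Φ (T₀.powerset : Set (Finset V)) := by
    intro T hT T' hT' h
    have hT : T ⊆ T₀ := by simpa using hT
    have hT' : T' ⊆ T₀ := by simpa using hT'
    have key : ∀ u ∈ T₀, (u ∈ T ↔ u ∈ T') := by
      intro u hu
      have hu' := Finset.mem_sdiff.1 (hT₀ hu)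
      have hadj := mem_inNbrs.1 hu'.1
      have := congrArg (fun D : Digraph {v : V // v ∉ F} => D.Adj ⟨u, hu'.2⟩ ⟨i, hi⟩) h
      simp only [Φ, hadj, true_and, eq_iff_iff, not_iff_not] at this
      exact this
    ext u
    exact ⟨fun hu => (key u (hT hu)).1 hu, fun hu => (key u (hT' hu)).2 hu⟩
  have := Set.ncard_le_ncard_of_injOn Φ hmaps hinj (finite_setOf_isReducedGraph G f F)
  rw [Set.ncard_coe_finset, Finset.card_powerset, hT₀card] at this
  exact lt_of_lt_of_le Nat.lt_two_pow_self this

end Graphs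

/-! ### Convex functions on a set of reals and their minimizers. -/

section Convex

variable {X : Set ℝ} {L : ℝ}

lemma Admissible.gradient_le {h h' : ℝ → ℝ} (hh : Admissible X L h h') {x y : ℝ} (hx : x ∈ X)
    (hy : y ∈ X) : h x + h' x * (y - x) ≤ h y := by
  rcases lt_trichotomy x y with hxy | rfl | hxy
  · have := hh.convex.le_slope_of_hasDerivWithinAt hx hy hxy (hh.hasDeriv x hx)
    rw [slope_def_field, le_div_iff₀ (sub_pos.2 hxy)] at this
    linarith
  · simp
  · have := hh.convex.slope_le_of_hasDerivWithinAt hy hx hxy (hh.hasDeriv x hx)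
    rw [slope_def_field, div_le_iff₀ (sub_pos.2 hxy)] at this
    linarith

lemma Admissible.monotoneOn {h h' : ℝ → ℝ} (hh : Admissible X L h h') : MonotoneOn h' X := by
  intro x hx y hy hxy
  rcases hxy.eq_or_lt with rfl | hxy
  · rfl
  · have h1 := hh.gradient_le hx hy
    have h2 := hh.gradient_le hy hx
    have h3 : 0 ≤ (h' y - h' x) * (y - x) := by linarith
    exact sub_nonneg.1 (nonneg_of_mul_nonneg_left h3 (sub_pos.2 hxy))

variable {W : Type*} [Fintype W] {h h' : W → ℝ → ℝ}

/-- The first-order condition is a variational inequality because the gradient need not vanish at an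
endpoint of `X`. -/
lemma mem_argminOn_sum_iff (hX : Convex ℝ X) (hadm : ∀ i, Admissible X L (h i) (h' i))
    {α : W → ℝ} (hα : ∀ i, 0 ≤ α i) {x : ℝ} (hx : x ∈ X) :
    x ∈ argminOn X (fun y => ∑ i, α i * h i y) ↔
      ∀ y ∈ X, 0 ≤ (∑ i, α i * h' i x) * (y - x) := by
  constructor
  · rintro ⟨-, hmin⟩ y hy
    have hd : HasDerivWithinAt (fun y => ∑ i, α i * h i y) (∑ i, α i * h' i x) X x :=
      HasDerivWithinAt.fun_sum fun i _ => ((hadm i).hasDeriv x hx).const_mul (α i)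
    have hm : IsMinOn (fun y => ∑ i, α i * h i y) X x := fun y hy => hmin y hy
    have := (hm.localize).hasFDerivWithinAt_nonneg hd.hasFDerivWithinAt
      (sub_mem_posTangentConeAt_of_segment_subset (hX.segment_subset hx hy))
    simpa [mul_comm] using this
  · intro H
    refine ⟨hx, fun y hy => ?_⟩
    have h1 : ∑ i, α i * (h i x + h' i x * (y - x)) ≤ ∑ i, α i * h i y :=
      Finset.sum_le_sum fun i _ => mul_le_mul_of_nonneg_left ((hadm i).gradient_le hx hy) (hα i)
    have h2 : ∑ i, α i * (h i x + h' i x * (y - x)) =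
        ∑ i, α i * h i x + (∑ i, α i * h' i x) * (y - x) := by
      rw [Finset.sum_mul, ← Finset.sum_add_distrib]
      exact Finset.sum_congr rfl fun i _ => by ring
    have := H y hy
    dsimp only
    linarith

lemma le_of_mem_segment_argminOn {g : ℝ → ℝ} (hg : ConvexOn ℝ X g) {y c x : ℝ}
    (hy : y ∈ argminOn X g) (hx : x ∈ X) (hc : c ∈ segment ℝ y x) : g c ≤ g x := by
  have := hg.le_on_segment hy.1 hx hc
  rwa [max_eq_right (hy.2 x hx)] at this

/-- A nonnegative combination of admissible functions has a minimizer. -/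
lemma argminOn_sum_nonempty [Nonempty W] (hX : Convex ℝ X)
    (hadm : ∀ i, Admissible X L (h i) (h' i)) {α : W → ℝ} (hα : ∀ i, 0 ≤ α i) :
    (argminOn X (fun y => ∑ i, α i * h i y)).Nonempty := by
  choose y hy using fun i => (hadm i).argmin_nonempty
  obtain ⟨k, -, hk⟩ := Finset.exists_min_image Finset.univ y Finset.univ_nonempty
  obtain ⟨l, -, hl⟩ := Finset.exists_max_image Finset.univ y Finset.univ_nonempty
  have hIcc : Set.Icc (y k) (y l) ⊆ X := hX.ordConnected.out (hy k).1 (hy l).1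
  have hcont : ContinuousOn (fun y => ∑ i, α i * h i y) X :=
    continuousOn_finsetSum _ fun i _ => continuousOn_const.mul
      fun x hx => ((hadm i).hasDeriv x hx).continuousWithinAt
  obtain ⟨z, hz, hzmin⟩ := isCompact_Icc.exists_isMinOn
    (Set.nonempty_Icc.2 (hk l (Finset.mem_univ l))) (hcont.mono hIcc)
  -- Moving from `x` towards a minimizer of every `h i` increases none of them, so a point outside
  -- the hull of the chosen minimizers is no better than the nearer endpoint of the hull.
  have hseg : ∀ c ∈ Set.Icc (y k) (y l), ∀ x ∈ X, (∀ i, c ∈ segment ℝ (y i) x) →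
      ∑ i, α i * h i z ≤ ∑ i, α i * h i x := by
    intro c hc x hx hcs
    refine (hzmin hc).trans (Finset.sum_le_sum fun i _ => mul_le_mul_of_nonneg_left ?_ (hα i))
    exact le_of_mem_segment_argminOn (hadm i).convex (hy i) hx (hcs i)
  have hkl : y k ≤ y l := hk l (Finset.mem_univ l)
  refine ⟨z, hIcc hz, fun x hx => ?_⟩
  rcases le_total x (y k) with h1 | h1
  · refine hseg (y k) ⟨le_rfl, hkl⟩ x hx fun i => ?_
    rw [segment_symm, segment_eq_Icc (h1.trans (hk i (Finset.mem_univ i)))]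
    exact ⟨h1, hk i (Finset.mem_univ i)⟩
  rcases le_total x (y l) with h2 | h2
  · exact hzmin ⟨h1, h2⟩
  · refine hseg (y l) ⟨hkl, le_rfl⟩ x hx fun i => ?_
    rw [segment_eq_Icc ((hl i (Finset.mem_univ i)).trans h2)]
    exact ⟨hl i (Finset.mem_univ i), h2⟩

end Convex

/-! ### Valid weights and the interval of their minimizers. -/

section ValidWeights

variable {W : Type*} [Fintype W]

/-- The weight vectors with at least `γ` entries that are at least `β`. -/
def validWeights (W : Type*) [Fintype W] (β : ℝ) (γ : ℕ) : Set (W → ℝ) :=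
  {α | α ∈ stdSimplex ℝ W ∧ γ ≤ {i | β ≤ α i}.ncard}

/-- A finite union, over the index sets `S` on which the weights are required to be large, of closed
pieces of the simplex. -/
lemma isCompact_validWeights (β : ℝ) (γ : ℕ) : IsCompact (validWeights W β γ) := by
  classical
  have heq : validWeights W β γ = stdSimplex ℝ W ∩
      ⋃ S ∈ (Finset.univ : Finset (Finset W)).filter (fun S => γ ≤ S.card),
        {α : W → ℝ | ∀ i ∈ S, β ≤ α i} := by
    ext α
    simp only [validWeights, Set.mem_ofPred_eq, Set.mem_inter_iff, Set.mem_iUnion,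
      Finset.mem_filter, Finset.mem_univ, true_and, exists_prop]
    refine and_congr_right fun _ => ⟨fun hα => ?_, ?_⟩
    · refine ⟨Finset.univ.filter fun i => β ≤ α i, ?_, by simp⟩
      rwa [← Set.ncard_coe_finset, Finset.coe_filter_univ]
    · rintro ⟨S, hS, hSα⟩
      rw [← Set.ncard_coe_finset] at hS
      exact hS.trans (Set.ncard_le_ncard (fun i hi => hSα i hi) (Set.toFinite _))
  rw [heq]
  refine (isCompact_stdSimplex ℝ W).inter_right (isClosed_biUnion_finset fun S _ => ?_)
  simp only [Set.ofPred_forall]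
  exact isClosed_iInter fun i => isClosed_iInter fun _ =>
    isClosed_le continuous_const (continuous_apply i)

lemma uniform_mem_validWeights [Nonempty W] {β : ℝ} {γ : ℕ} (hγ : γ ≤ Fintype.card W)
    (hβ : β ≤ (Fintype.card W : ℝ)⁻¹) :
    (fun _ => (Fintype.card W : ℝ)⁻¹) ∈ validWeights W β γ := by
  refine ⟨⟨fun i => by positivity, by simp⟩, ?_⟩
  simpa [hβ, Set.ncard_univ] using hγ

/-- The valid weights are star-shaped about the uniform weights. -/
lemma combo_uniform_mem_validWeights [Nonempty W] {β : ℝ} {γ : ℕ} (hγ : γ ≤ Fintype.card W)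
    (hβ : β ≤ (Fintype.card W : ℝ)⁻¹) {α : W → ℝ} (hα : α ∈ validWeights W β γ) {a b : ℝ}
    (ha : 0 ≤ a) (hb : 0 ≤ b) (hab : a + b = 1) :
    a • α + b • (fun _ => (Fintype.card W : ℝ)⁻¹) ∈ validWeights W β γ := by
  refine ⟨convex_stdSimplex ℝ W hα.1 (uniform_mem_validWeights hγ hβ).1 ha hb hab,
    hα.2.trans (Set.ncard_le_ncard (fun i hi => ?_) (Set.toFinite _))⟩
  have h1 := mul_le_mul_of_nonneg_left (show β ≤ α i from hi) ha
  have h2 := mul_le_mul_of_nonneg_left hβ hb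
  have h3 : β = a * β + b * β := by rw [← add_mul, hab, one_mul]
  simp only [Set.mem_ofPred_eq, Pi.add_apply, Pi.smul_apply, smul_eq_mul]
  linarith

lemma exists_combo_eq_zero {u v : ℝ} (hu : 0 ≤ u) (hv : v ≤ 0) :
    ∃ a b : ℝ, 0 ≤ a ∧ 0 ≤ b ∧ a + b = 1 ∧ a * u + b * v = 0 := by
  have : (0 : ℝ) ∈ segment ℝ v u := by rw [segment_eq_Icc (hv.trans hu)]; exact ⟨hv, hu⟩
  obtain ⟨a, b, ha, hb, hab, h⟩ := this
  exact ⟨b, a, hb, ha, by linarith, by simp at h; linarith⟩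

/-- The intermediate value property of a linear form on the valid weights. -/
lemma exists_validWeights_sum_eq_zero [Nonempty W] {β : ℝ} {γ : ℕ} (hγ : γ ≤ Fintype.card W)
    (hβ : β ≤ (Fintype.card W : ℝ)⁻¹) {α₁ α₂ : W → ℝ} (h₁ : α₁ ∈ validWeights W β γ)
    (h₂ : α₂ ∈ validWeights W β γ) {q : W → ℝ} (hq₁ : 0 ≤ ∑ i, α₁ i * q i)
    (hq₂ : ∑ i, α₂ i * q i ≤ 0) : ∃ α ∈ validWeights W β γ, ∑ i, α i * q i = 0 := by
  have key : ∀ (α : W → ℝ) (a b : ℝ),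
      ∑ i, (a • α + b • (fun _ : W => (Fintype.card W : ℝ)⁻¹) : W → ℝ) i * q i =
        a * ∑ i, α i * q i + b * ∑ i, (Fintype.card W : ℝ)⁻¹ * q i := by
    intro α a b
    rw [Finset.mul_sum, Finset.mul_sum, ← Finset.sum_add_distrib]
    refine Finset.sum_congr rfl fun i _ => ?_
    simp only [Pi.add_apply, Pi.smul_apply, smul_eq_mul]
    ring
  -- The valid weights need not be convex, so `α₁` and `α₂` are not joined directly. The form
  -- changes sign on the segment from one of them to the uniform weights, and that segment stays
  -- valid.
  rcases le_total 0 (∑ i, (Fintype.card W : ℝ)⁻¹ * q i) with hq | hq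
  · obtain ⟨a, b, ha, hb, hab, h⟩ := exists_combo_eq_zero hq hq₂
    refine ⟨_, combo_uniform_mem_validWeights hγ hβ h₂ hb ha (by linarith), ?_⟩
    rw [key]
    linarith
  · obtain ⟨a, b, ha, hb, hab, h⟩ := exists_combo_eq_zero hq₁ hq
    exact ⟨_, combo_uniform_mem_validWeights hγ hβ h₁ ha hb hab, by rw [key, h]⟩

/-- The minimizers over `X` of the combinations of the `h i` with valid weights. -/
def weightedArgmin (X : Set ℝ) (h : W → ℝ → ℝ) (β : ℝ) (γ : ℕ) : Set ℝ :=
  {x | ∃ α ∈ validWeights W β γ, x ∈ argminOn X fun y => ∑ i, α i * h i y}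

variable {X : Set ℝ} {L : ℝ} {h h' : W → ℝ → ℝ} {β : ℝ} {γ : ℕ}

lemma mem_weightedArgmin_of_sum_eq_zero (hX : Convex ℝ X)
    (hadm : ∀ i, Admissible X L (h i) (h' i)) {α : W → ℝ} (hα : α ∈ validWeights W β γ) {x : ℝ}
    (hx : x ∈ X) (hzero : ∑ i, α i * h' i x = 0) : x ∈ weightedArgmin X h β γ :=
  ⟨α, hα, (mem_argminOn_sum_iff hX hadm hα.1.1 hx).2 fun y _ => by rw [hzero, zero_mul]⟩

lemma sum_gradient_nonneg_of_argmin_lt (hX : Convex ℝ X)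
    (hadm : ∀ i, Admissible X L (h i) (h' i)) {α : W → ℝ} (hα : ∀ i, 0 ≤ α i) {y x : ℝ}
    (hy : y ∈ argminOn X fun y => ∑ i, α i * h i y) (hx : x ∈ X) (hyx : y < x) :
    0 ≤ ∑ i, α i * h' i x := by
  have h1 := (mem_argminOn_sum_iff hX hadm hα hy.1).1 hy x hx
  refine (nonneg_of_mul_nonneg_left h1 (sub_pos.2 hyx)).trans ?_
  exact Finset.sum_le_sum fun i _ =>
    mul_le_mul_of_nonneg_left ((hadm i).monotoneOn hy.1 hx hyx.le) (hα i)

lemma sum_gradient_nonpos_of_lt_argmin (hX : Convex ℝ X)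
    (hadm : ∀ i, Admissible X L (h i) (h' i)) {α : W → ℝ} (hα : ∀ i, 0 ≤ α i) {y x : ℝ}
    (hy : y ∈ argminOn X fun y => ∑ i, α i * h i y) (hx : x ∈ X) (hxy : x < y) :
    ∑ i, α i * h' i x ≤ 0 := by
  have h1 := (mem_argminOn_sum_iff hX hadm hα hy.1).1 hy x hx
  have h2 : ∑ i, α i * h' i y ≤ 0 := by
    by_contra hcon
    exact absurd h1 (not_le.2 (mul_neg_of_pos_of_neg (not_le.1 hcon) (sub_neg.2 hxy)))
  refine le_trans ?_ h2
  exact Finset.sum_le_sum fun i _ =>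
    mul_le_mul_of_nonneg_left ((hadm i).monotoneOn hx hy.1 hxy.le) (hα i)

lemma weightedArgmin_nonempty [Nonempty W] (hX : Convex ℝ X)
    (hadm : ∀ i, Admissible X L (h i) (h' i)) (hγ : γ ≤ Fintype.card W)
    (hβ : β ≤ (Fintype.card W : ℝ)⁻¹) : (weightedArgmin X h β γ).Nonempty := by
  have hu := uniform_mem_validWeights hγ hβ
  obtain ⟨y, hy⟩ := argminOn_sum_nonempty hX hadm hu.1.1
  exact ⟨y, _, hu, hy⟩

/-- Strictly between two minimizers, monotone gradients give one valid combination that is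
nonnegative and one that is nonpositive, hence one that vanishes. -/
lemma ordConnected_weightedArgmin [Nonempty W] (hX : Convex ℝ X)
    (hadm : ∀ i, Admissible X L (h i) (h' i)) (hγ : γ ≤ Fintype.card W)
    (hβ : β ≤ (Fintype.card W : ℝ)⁻¹) : (weightedArgmin X h β γ).OrdConnected := by
  refine ⟨?_⟩
  rintro y₁ ⟨α₁, hα₁, hy₁⟩ y₂ ⟨α₂, hα₂, hy₂⟩ x ⟨h₁, h₂⟩
  rcases h₁.eq_or_lt with rfl | h₁
  · exact ⟨α₁, hα₁, hy₁⟩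
  rcases h₂.eq_or_lt with rfl | h₂
  · exact ⟨α₂, hα₂, hy₂⟩
  have hx : x ∈ X := hX.ordConnected.out hy₁.1 hy₂.1 ⟨h₁.le, h₂.le⟩
  obtain ⟨α, hα, hzero⟩ := exists_validWeights_sum_eq_zero hγ hβ hα₁ hα₂
    (sum_gradient_nonneg_of_argmin_lt hX hadm hα₁.1.1 hy₁ hx h₁)
    (sum_gradient_nonpos_of_lt_argmin hX hadm hα₂.1.1 hy₂ hx h₂)
  exact mem_weightedArgmin_of_sum_eq_zero hX hadm hα hx hzero

/-- To the right of the minimizers the gradients of all valid functions are bounded away from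
zero. -/
lemma exists_pos_le_sum_gradient [Nonempty W] (hX : Convex ℝ X)
    (hadm : ∀ i, Admissible X L (h i) (h' i)) (hγ : γ ≤ Fintype.card W)
    (hβ : β ≤ (Fintype.card W : ℝ)⁻¹) {x : ℝ} (hx : x ∈ X)
    (hlt : ∀ y ∈ weightedArgmin X h β γ, y < x) :
    ∃ c > 0, ∀ α ∈ validWeights W β γ, c ≤ ∑ i, α i * h' i x := by
  obtain ⟨y, α₁, hα₁, hy⟩ := weightedArgmin_nonempty hX hadm hγ hβ
  have hq₁ := sum_gradient_nonneg_of_argmin_lt hX hadm hα₁.1.1 hy hx (hlt y ⟨α₁, hα₁, hy⟩)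
  obtain ⟨α₀, hα₀, hmin⟩ := (isCompact_validWeights (W := W) β γ).exists_isMinOn ⟨α₁, hα₁⟩
    (f := fun α => ∑ i, α i * h' i x) (by fun_prop)
  refine ⟨∑ i, α₀ i * h' i x, ?_, fun α hα => hmin hα⟩
  -- If the smallest combined gradient were not positive, some valid combination would vanish at
  -- `x`, making `x` itself a minimizer.
  by_contra hcon
  obtain ⟨α, hα, hzero⟩ := exists_validWeights_sum_eq_zero hγ hβ hα₁ hα₀ hq₁ (not_lt.1 hcon)
  exact lt_irrefl x (hlt x (mem_weightedArgmin_of_sum_eq_zero hX hadm hα hx hzero))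

/-- To the left of the minimizers the gradients of all valid functions are bounded away from
zero. -/
lemma exists_pos_sum_gradient_le_neg [Nonempty W] (hX : Convex ℝ X)
    (hadm : ∀ i, Admissible X L (h i) (h' i)) (hγ : γ ≤ Fintype.card W)
    (hβ : β ≤ (Fintype.card W : ℝ)⁻¹) {x : ℝ} (hx : x ∈ X)
    (hlt : ∀ y ∈ weightedArgmin X h β γ, x < y) :
    ∃ c > 0, ∀ α ∈ validWeights W β γ, ∑ i, α i * h' i x ≤ -c := by
  obtain ⟨y, α₁, hα₁, hy⟩ := weightedArgmin_nonempty hX hadm hγ hβ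
  have hq₁ := sum_gradient_nonpos_of_lt_argmin hX hadm hα₁.1.1 hy hx (hlt y ⟨α₁, hα₁, hy⟩)
  obtain ⟨α₀, hα₀, hmax⟩ := (isCompact_validWeights (W := W) β γ).exists_isMaxOn ⟨α₁, hα₁⟩
    (f := fun α => ∑ i, α i * h' i x) (by fun_prop)
  refine ⟨-∑ i, α₀ i * h' i x, ?_, fun α hα => by rw [neg_neg]; exact hmax hα⟩
  by_contra hcon
  obtain ⟨α, hα, hzero⟩ := exists_validWeights_sum_eq_zero hγ hβ hα₀ hα₁ (by linarith) hq₁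
  exact lt_irrefl x (hlt x (mem_weightedArgmin_of_sum_eq_zero hX hadm hα hx hzero))

end ValidWeights

/-! ### Descent of the weighted average state. -/

section Descent

/-- When `X` has a point below `u`, projection cannot push `u` upwards. This keeps upper bounds on a
gradient step valid after projection. -/
lemma IsProjection.le_of_lt {X : Set ℝ} (hX : Convex ℝ X) {u z y : ℝ} (hz : IsProjection X u z)
    (hy : y ∈ X) (hyu : y < u) : z ≤ u := by
  by_contra hcon
  have hu : u ∈ X := hX.ordConnected.out hy hz.1 ⟨hyu.le, (not_le.1 hcon).le⟩
  have := hz.2 u hu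
  rw [sub_self, abs_zero, abs_nonpos_iff, sub_eq_zero] at this
  exact hcon this.le

lemma IsProjection.abs_sub_le {X : Set ℝ} (hX : Convex ℝ X) {u z v : ℝ} (hz : IsProjection X u z)
    (hv : v ∈ X) : |z - v| ≤ |u - v| := by
  have key := hz.2
  by_cases hu : u ∈ X
  · have := key u hu
    rw [sub_self, abs_zero, abs_nonpos_iff, sub_eq_zero] at this
    rw [this]
  · have hsep : (u < z ∧ u < v) ∨ (z < u ∧ v < u) := by
      have h1 : ∀ a ∈ X, ∀ b ∈ X, ¬ (a ≤ u ∧ u ≤ b) := fun a ha b hb h =>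
        hu (hX.ordConnected.out ha hb h)
      have h2 := h1 z hz.1 v hv
      have h3 := h1 v hv z hz.1
      by_contra hcon
      grind
    have hv' := key v hv
    rcases hsep with ⟨h1, h2⟩ | ⟨h1, h2⟩
    · rw [abs_of_pos (sub_pos.2 h1), abs_of_pos (sub_pos.2 h2)] at hv'
      rw [abs_le, abs_of_neg (sub_neg.2 h2)]
      constructor <;> linarith
    · rw [abs_of_neg (sub_neg.2 h1), abs_of_neg (sub_neg.2 h2)] at hv'
      rw [abs_le, abs_of_pos (sub_pos.2 h2)]
      constructor <;> linarith

/-- A sequence with small increments that decreases whenever it is above `s` is eventually below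
`s + ε`. -/
lemma eventually_lt_of_descent {z lam : ℕ → ℝ} {s ε c L : ℝ} (hε : 0 < ε) (hc : 0 < c)
    (hlam : ∀ t, 0 ≤ lam t) (hlam0 : Tendsto lam atTop (𝓝 0))
    (hsum : Tendsto (fun T => ∑ t ∈ Finset.range T, lam t) atTop atTop)
    (hstep : ∀ t, z (t + 1) ≤ z t + L * lam t)
    (hdesc : ∀ᶠ t in atTop, s ≤ z t → z (t + 1) ≤ z t - c * lam t) :
    ∀ᶠ t in atTop, z t < s + ε := by
  have hsmall : ∀ᶠ t in atTop, L * lam t < ε := by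
    have : Tendsto (fun t => L * lam t) atTop (𝓝 0) := by simpa using hlam0.const_mul L
    exact this.eventually_lt_const hε
  obtain ⟨T, hT⟩ := eventually_atTop.1 (hdesc.and hsmall)
  -- Staying above `s` would force a total decrease of `c` times a divergent sum.
  obtain ⟨t₀, ht₀, hz₀⟩ : ∃ t₀ ≥ T, z t₀ < s := by
    by_contra! hcon
    have hbound : ∀ k, c * ∑ t ∈ Finset.range (T + k), lam t ≤
        z T - z (T + k) + c * ∑ t ∈ Finset.range T, lam t := by
      intro k
      induction k with
      | zero => simp
      | succ k ih =>
        have h1 := (hT (T + k) (by omega)).1 (hcon (T + k) (by omega))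
        rw [← add_assoc, Finset.sum_range_succ, mul_add]
        linarith
    obtain ⟨k, hk, hk'⟩ := ((hsum.const_mul_atTop hc).eventually_gt_atTop
      (z T - s + c * ∑ t ∈ Finset.range T, lam t)).and (eventually_ge_atTop T) |>.exists
    obtain ⟨l, rfl⟩ := Nat.exists_eq_add_of_le hk'
    linarith [hbound l, hcon (T + l) (by omega)]
  -- The sequence is then trapped: below `s` it rises by less than `ε` in one step, and from `s` on
  -- it does not rise.
  refine eventually_atTop.2 ⟨t₀, fun t ht => ?_⟩
  induction t, ht using Nat.le_induction with
  | base => linarith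
  | succ t ht ih =>
    obtain ⟨h1, h2⟩ := hT t (ht₀.trans ht)
    rcases lt_or_ge (z t) s with h3 | h3
    · linarith [hstep t]
    · have := h1 h3
      have := mul_nonneg hc.le (hlam t)
      linarith

variable {W : Type*} [Fintype W]

/-- The reason for using absolute probabilities: averaging leaves the weighted state unchanged, so
only gradients and projections move it. -/
lemma dotProduct_mulVec_absoluteProbability {M : ℕ → Matrix W W ℝ} {p : ℕ → W → ℝ}
    (hpM : ∀ t, p t = p (t + 1) ᵥ* M t) (t : ℕ) (x : W → ℝ) :
    p (t + 1) ⬝ᵥ (M t *ᵥ x) = p t ⬝ᵥ x := by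
  rw [Matrix.dotProduct_mulVec, ← hpM]

lemma abs_dotProduct_sub_le {p : W → ℝ} (hp : p ∈ stdSimplex ℝ W) {u v : W → ℝ} {c : ℝ}
    (huv : ∀ i, |u i - v i| ≤ c) : |p ⬝ᵥ u - p ⬝ᵥ v| ≤ c := by
  rw [← dotProduct_sub]
  calc |∑ i, p i * (u i - v i)| ≤ ∑ i, |p i * (u i - v i)| := Finset.abs_sum_le_sum_abs _ _
    _ ≤ ∑ i, p i * c := Finset.sum_le_sum fun i _ => by
      rw [abs_mul, abs_of_nonneg (hp.1 i)]
      exact mul_le_mul_of_nonneg_left (huv i) (hp.1 i)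
    _ = c := by rw [← Finset.sum_mul, hp.2, one_mul]

lemma abs_dotProduct_sub_const_le {p : W → ℝ} (hp : p ∈ stdSimplex ℝ W) {u : W → ℝ} {b c : ℝ}
    (hu : ∀ i, |u i - b| ≤ c) : |p ⬝ᵥ u - b| ≤ c := by
  have h := abs_dotProduct_sub_le hp (u := u) (v := fun _ => b) hu
  have hb : p ⬝ᵥ (fun _ => b) = b := by
    simp only [dotProduct]
    rw [← Finset.sum_mul, hp.2, one_mul]
  rwa [hb] at h

variable [DecidableEq W]

/-- A distributed projected subgradient iteration on the line: averaging by row stochastic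
matrices `M t` with absolute probabilities `p t`, vanishing disagreement and step sizes `lam`. -/
structure IsDescent (X : Set ℝ) (L : ℝ) (g : W → ℝ → ℝ) (M : ℕ → Matrix W W ℝ) (lam : ℕ → ℝ)
    (x : ℕ → W → ℝ) (p : ℕ → W → ℝ) : Prop where
  convex : Convex ℝ X
  monotone : ∀ i, MonotoneOn (g i) X
  bounded : ∀ i, ∀ y ∈ X, |g i y| ≤ L
  stochastic : ∀ t, M t ∈ rowStochastic ℝ W
  mem_simplex : ∀ t, p t ∈ stdSimplex ℝ W
  absolute : ∀ t, p t = p (t + 1) ᵥ* M t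
  mem : ∀ t i, x t i ∈ X
  update : ∀ t i, IsProjection X ((M t *ᵥ x t) i - lam t * g i (x t i)) (x (t + 1) i)
  step_nonneg : ∀ t, 0 ≤ lam t
  step_tendsto : Tendsto lam atTop (𝓝 0)
  step_sum : Tendsto (fun T => ∑ t ∈ Finset.range T, lam t) atTop atTop
  consensus : ∀ i j, Tendsto (fun t => |x t i - x t j|) atTop (𝓝 0)

lemma mulVec_mem_of_convex {X : Set ℝ} (hX : Convex ℝ X) {P : Matrix W W ℝ}
    (hP : P ∈ rowStochastic ℝ W) {y : W → ℝ} (hy : ∀ i, y i ∈ X) (i : W) : (P *ᵥ y) i ∈ X := by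
  have := hX.sum_mem (t := Finset.univ) (w := P i) (z := y) (fun l _ => hP.1 i l)
    (sum_row_of_mem_rowStochastic hP i) (fun l _ => hy l)
  simpa [Matrix.mulVec, dotProduct] using this

/-- One projected step moves an average in `X` by at most the step size times the gradient bound. -/
lemma abs_step_le {X : Set ℝ} (hX : Convex ℝ X) {v lam d z L : ℝ} (hlam : 0 ≤ lam) (hd : |d| ≤ L)
    (hv : v ∈ X) (hz : IsProjection X (v - lam * d) z) : |z - v| ≤ L * lam := by
  refine (hz.abs_sub_le hX hv).trans ?_
  rw [sub_sub_cancel_left, abs_neg, abs_mul, abs_of_nonneg hlam, mul_comm]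
  exact mul_le_mul_of_nonneg_right hd hlam

variable {X : Set ℝ} {L : ℝ} {g : W → ℝ → ℝ} {M : ℕ → Matrix W W ℝ} {lam : ℕ → ℝ}
  {x : ℕ → W → ℝ} {p : ℕ → W → ℝ}

lemma IsDescent.eventually_near (hD : IsDescent X L g M lam x p) {ε : ℝ} (hε : 0 < ε) :
    ∀ᶠ t in atTop, ∀ i, |p t ⬝ᵥ x t - x t i| ≤ ε := by
  have : ∀ᶠ t in atTop, ∀ i j, |x t i - x t j| < ε :=
    eventually_all.2 fun i => eventually_all.2 fun j =>
      (hD.consensus i j).eventually_lt_const hε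
  filter_upwards [this] with t ht i
  exact abs_dotProduct_sub_const_le (hD.mem_simplex t) fun j => (ht j i).le

/-- If the combined gradients at `y` are bounded below by a positive constant, the average state
is eventually at most slightly larger than `y`. -/
lemma IsDescent.eventually_lt (hD : IsDescent X L g M lam x p) {y c ε : ℝ} (hy : y ∈ X)
    (hc : 0 < c) (hε : 0 < ε) (hgrad : ∀ t, c ≤ ∑ i, p t i * g i y) :
    ∀ᶠ t in atTop, p t ⬝ᵥ x t < y + ε := by
  have hε4 : 0 < ε / 4 := by positivity
  have hsmall : ∀ᶠ t in atTop, L * lam t < ε / 4 := by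
    have : Tendsto (fun t => L * lam t) atTop (𝓝 0) := by simpa using hD.step_tendsto.const_mul L
    exact this.eventually_lt_const hε4
  -- The descent threshold is `y + ε / 2`. Above it all states exceed `y` by `ε / 4`, so
  -- monotonicity bounds their gradients below by those at `y`; a step shorter than `ε / 4` also
  -- leaves the unprojected point above `y`, as `IsProjection.le_of_lt` requires.
  have key : ∀ᶠ t in atTop, p t ⬝ᵥ x t < (y + ε / 2) + ε / 2 := by
    refine eventually_lt_of_descent (c := c) (L := L) (half_pos hε) hc hD.step_nonneg
      hD.step_tendsto hD.step_sum (fun t => ?_) ?_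
    · have h1 := abs_dotProduct_sub_le (hD.mem_simplex (t + 1)) (u := x (t + 1))
        (v := M t *ᵥ x t) fun i => abs_step_le hD.convex (hD.step_nonneg t)
          (hD.bounded i _ (hD.mem t i))
          (mulVec_mem_of_convex hD.convex (hD.stochastic t) (hD.mem t) i) (hD.update t i)
      rw [dotProduct_mulVec_absoluteProbability hD.absolute] at h1
      linarith [(abs_le.1 h1).2]
    · filter_upwards [hsmall, hD.eventually_near hε4] with t ht hnear hz
      have hx : ∀ i, y + ε / 4 ≤ x t i := fun i => by
        linarith [(abs_le.1 (hnear i)).2]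
      have hnext : ∀ i, x (t + 1) i ≤ (M t *ᵥ x t) i - lam t * g i y := by
        intro i
        have hv := le_mulVec_of_le (hD.stochastic t) hx i
        have hb := (abs_le.1 (hD.bounded i _ (hD.mem t i))).2
        have h1 := mul_le_mul_of_nonneg_left hb (hD.step_nonneg t)
        have h2 := (hD.update t i).le_of_lt hD.convex hy (by linarith)
        have h3 := hD.monotone i hy (hD.mem t i) (by linarith [hx i])
        have h4 := mul_le_mul_of_nonneg_left h3 (hD.step_nonneg t)
        linarith
      calc p (t + 1) ⬝ᵥ x (t + 1)
          ≤ ∑ i, p (t + 1) i * ((M t *ᵥ x t) i - lam t * g i y) :=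
            Finset.sum_le_sum fun i _ =>
              mul_le_mul_of_nonneg_left (hnext i) ((hD.mem_simplex _).1 i)
        _ = p (t + 1) ⬝ᵥ (M t *ᵥ x t) - lam t * ∑ i, p (t + 1) i * g i y := by
            rw [Finset.mul_sum, dotProduct, ← Finset.sum_sub_distrib]
            exact Finset.sum_congr rfl fun i _ => by ring
        _ ≤ p t ⬝ᵥ x t - c * lam t := by
            rw [dotProduct_mulVec_absoluteProbability hD.absolute]
            have := mul_le_mul_of_nonneg_left (hgrad (t + 1)) (hD.step_nonneg t)
            linarith
  filter_upwards [key] with t ht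
  linarith

/-- Reflection turns the upper bound on the average into the lower bound. -/
lemma IsDescent.neg (hD : IsDescent X L g M lam x p) :
    IsDescent {y | -y ∈ X} L (fun i y => -g i (-y)) M lam (fun t i => -x t i) p where
  convex := hD.convex.neg
  monotone i y hy z hz hyz := neg_le_neg (hD.monotone i hz hy (neg_le_neg hyz))
  bounded i y hy := by rw [abs_neg]; exact hD.bounded i _ hy
  stochastic := hD.stochastic
  mem_simplex := hD.mem_simplex
  absolute := hD.absolute
  mem t i := by simpa using hD.mem t i
  update t i := by
    have h := hD.update t i
    have hneg : (M t *ᵥ fun i => -x t i) i = -(M t *ᵥ x t) i :=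
      congrFun (Matrix.mulVec_neg (x t) (M t)) i
    refine ⟨by simpa using h.1, fun y hy => ?_⟩
    have h2 := h.2 (-y) hy
    rw [hneg, neg_neg, abs_sub_comm, abs_sub_comm y]
    convert h2 using 2 <;> ring
  step_nonneg := hD.step_nonneg
  step_tendsto := hD.step_tendsto
  step_sum := hD.step_sum
  consensus i j := by
    refine (hD.consensus i j).congr fun t => ?_
    rw [abs_sub_comm]
    congr 1
    ring

lemma IsDescent.eventually_gt (hD : IsDescent X L g M lam x p) {y c ε : ℝ} (hy : y ∈ X)
    (hc : 0 < c) (hε : 0 < ε) (hgrad : ∀ t, ∑ i, p t i * g i y ≤ -c) :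
    ∀ᶠ t in atTop, y - ε < p t ⬝ᵥ x t := by
  have h := hD.neg.eventually_lt (y := -y) (by simpa using hy) hc hε (fun t => by
    simp only [neg_neg, mul_neg, Finset.sum_neg_distrib]
    linarith [hgrad t])
  filter_upwards [h] with t ht
  have : p t ⬝ᵥ (fun i => -x t i) = -(p t ⬝ᵥ x t) := dotProduct_neg _ _
  rw [this] at ht
  linarith

/-- The states of a distributed projected gradient iteration approach the minimizers of the valid
functions if all absolute probabilities are valid weights. -/
lemma IsDescent.tendsto_infDist [Nonempty W] {h h' : W → ℝ → ℝ} {β : ℝ} {γ : ℕ}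
    (hD : IsDescent X L h' M lam x p) (hadm : ∀ i, Admissible X L (h i) (h' i))
    (hγ : γ ≤ Fintype.card W) (hβ : β ≤ (Fintype.card W : ℝ)⁻¹)
    (hp : ∀ t, p t ∈ validWeights W β γ) (i : W) :
    Tendsto (fun t => Metric.infDist (x t i) (weightedArgmin X h β γ)) atTop (𝓝 0) := by
  set Y := weightedArgmin X h β γ with hY
  have hYne : Y.Nonempty := weightedArgmin_nonempty hD.convex hadm hγ hβ
  have hYX : Y ⊆ X := fun y ⟨_, _, hy⟩ => hy.1
  have hzX : ∀ t, p t ⬝ᵥ x t ∈ X := fun t => by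
    have := hD.convex.sum_mem (t := Finset.univ) (fun l _ => (hD.mem_simplex t).1 l)
      (hD.mem_simplex t).2 (fun l _ => hD.mem t l)
    simpa [dotProduct] using this
  have upper : ∀ ε > 0, ∀ᶠ t in atTop, ∃ y ∈ Y, p t ⬝ᵥ x t < y + ε := by
    intro ε hε
    by_cases hbdd : BddAbove Y
    · obtain ⟨y, hy, hylt⟩ := exists_lt_of_lt_csSup hYne
        (show sSup Y - ε / 3 < sSup Y by linarith)
      -- If this point is outside `X`, convexity keeps all of `X`, and with it the average, below
      -- it.
      by_cases hmem : sSup Y + ε / 3 ∈ X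
      · obtain ⟨c, hc, hgrad⟩ := exists_pos_le_sum_gradient hD.convex hadm hγ hβ hmem
          fun y' hy' => lt_of_le_of_lt (le_csSup hbdd hy') (by linarith)
        filter_upwards [hD.eventually_lt hmem hc (show 0 < ε / 3 by positivity)
          fun t => hgrad _ (hp t)] with t ht
        exact ⟨y, hy, by linarith⟩
      · refine Eventually.of_forall fun t => ⟨y, hy, ?_⟩
        by_contra hcon
        refine hmem (hD.convex.ordConnected.out (hYX hy) (hzX t) ⟨?_, by linarith⟩)
        linarith [le_csSup hbdd hy]
    · refine Eventually.of_forall fun t => ?_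
      obtain ⟨y, hy, hlt⟩ := not_bddAbove_iff.1 hbdd (p t ⬝ᵥ x t)
      exact ⟨y, hy, by linarith⟩
  have lower : ∀ ε > 0, ∀ᶠ t in atTop, ∃ y ∈ Y, y - ε < p t ⬝ᵥ x t := by
    intro ε hε
    by_cases hbdd : BddBelow Y
    · obtain ⟨y, hy, hylt⟩ := exists_lt_of_csInf_lt hYne
        (show sInf Y < sInf Y + ε / 3 by linarith)
      by_cases hmem : sInf Y - ε / 3 ∈ X
      · obtain ⟨c, hc, hgrad⟩ := exists_pos_sum_gradient_le_neg hD.convex hadm hγ hβ hmem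
          fun y' hy' => lt_of_lt_of_le (by linarith) (csInf_le hbdd hy')
        filter_upwards [hD.eventually_gt hmem hc (show 0 < ε / 3 by positivity)
          fun t => hgrad _ (hp t)] with t ht
        exact ⟨y, hy, by linarith⟩
      · refine Eventually.of_forall fun t => ⟨y, hy, ?_⟩
        by_contra hcon
        refine hmem (hD.convex.ordConnected.out (hzX t) (hYX hy) ⟨by linarith, ?_⟩)
        linarith [csInf_le hbdd hy]
    · refine Eventually.of_forall fun t => ?_
      obtain ⟨y, hy, hlt⟩ := not_bddBelow_iff.1 hbdd (p t ⬝ᵥ x t)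
      exact ⟨y, hy, by linarith⟩
  have hOC : Y.OrdConnected := ordConnected_weightedArgmin hD.convex hadm hγ hβ
  rw [Metric.tendsto_nhds]
  intro ε hε
  filter_upwards [upper (ε / 3) (by positivity), lower (ε / 3) (by positivity),
    hD.eventually_near (show 0 < ε / 3 by positivity)] with t ⟨y₁, hy₁, h₁⟩ ⟨y₂, hy₂, h₂⟩ hnear
  obtain ⟨y, hy, hdist⟩ : ∃ y ∈ Y, |p t ⬝ᵥ x t - y| ≤ ε / 3 := by
    rcases lt_or_ge (p t ⬝ᵥ x t) y₂ with h | h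
    · exact ⟨y₂, hy₂, abs_le.2 ⟨by linarith, by linarith⟩⟩
    rcases lt_or_ge y₁ (p t ⬝ᵥ x t) with h3 | h3
    · exact ⟨y₁, hy₁, abs_le.2 ⟨by linarith, by linarith⟩⟩
    · exact ⟨_, hOC.out hy₂ hy₁ ⟨h, h3⟩, by rw [sub_self, abs_zero]; positivity⟩
  rw [Real.dist_eq, sub_zero, abs_of_nonneg Metric.infDist_nonneg]
  refine lt_of_le_of_lt (Metric.infDist_le_dist_of_mem hy) ?_
  rw [Real.dist_eq]
  have h1 := abs_le.1 (hnear i)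
  have h2 := abs_le.1 hdist
  exact abs_lt.2 ⟨by linarith, by linarith⟩

end Descent

/-! ### From executions to stochastic matrices. -/

section Execution

variable {V : Type*} [Fintype V] [DecidableEq V]

lemma sum_subtype_ite_mem (F N : Finset V) (u : V → ℝ) :
    ∑ j : {v : V // v ∉ F}, (if (j : V) ∈ N then u j else 0) = ∑ j ∈ N \ F, u j := by
  rw [← Finset.sum_subtype Fᶜ (by simp) (fun j => if j ∈ N then u j else 0), ← Finset.sum_filter]
  congr 1
  ext j
  simp [and_comm]

/-- One iteration as an averaging step over the non-faulty agents. -/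
lemma IsExecution.exists_matrix {G : Digraph V} {f : ℕ} {F : Finset V} (hF : F.card ≤ f)
    (hdeg : 0 < f → ∀ i, inDegree G i ≠ 2 * f) {X : Set ℝ} {h' : V → ℝ → ℝ} {stepsize : ℕ → ℝ}
    {x : ℕ → V → ℝ} {w : ℕ → V → V → ℝ} (hexec : IsExecution G f F X h' stepsize x w) (t : ℕ) :
    ∃ M ∈ rowStochastic ℝ {v : V // v ∉ F}, ∃ H, IsReducedGraph G f F H ∧
      (∀ i, 1 / ((maxInDegree G : ℝ) + 1 - 2 * f) ≤ M i i) ∧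
      (∀ i j, H.Adj j i → 1 / ((maxInDegree G : ℝ) + 1 - 2 * f) * (1 / 2) ^ (f + 1) ≤ M i j) ∧
      ∀ i : {v : V // v ∉ F}, IsProjection X
        ((M *ᵥ fun j => x t j) i - stepsize t * h' i (x t i)) (x (t + 1) i) := by
  choose! K hK hproj using hexec.update t
  have hcard : ∀ i ∉ F, (K i).card + 2 * f = inDegree G i := fun i hi => (hK i hi).card_add
  -- In-degree at least `2 * f` and different from `2 * f` ensures that some value survives when `f
  -- > 0`.
  have hweights := fun (i : V) (hi : i ∉ F) => (hK i hi).exists_weights hF (fun hf => by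
    have h1 := hcard i hi
    have h2 := hdeg hf i
    rw [inDegree] at h1 h2
    omega)
  choose! c hc0 hcw hcsum E hE hcE using hweights
  have hunit : ∀ i ∉ F, (inDegree G i : ℝ) + 1 - 2 * f = (K i).card + 1 := by
    intro i hi
    rw [← hcard i hi]
    push_cast
    ring
  have hunit_le : ∀ i ∉ F, 1 / ((maxInDegree G : ℝ) + 1 - 2 * f) ≤ 1 / ((K i).card + 1 : ℝ) := by
    intro i hi
    have h1 : inDegree G i ≤ maxInDegree G := Finset.le_sup (Finset.mem_univ i)
    have h2 : (inDegree G i : ℝ) ≤ maxInDegree G := by exact_mod_cast h1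
    have h3 := hunit i hi
    exact one_div_le_one_div_of_le (by positivity) (by linarith)
  let M : Matrix {v : V // v ∉ F} {v : V // v ∉ F} ℝ := fun i j =>
    1 / ((K i).card + 1 : ℝ) *
      ((if j = i then 1 else 0) + if (j : V) ∈ inNbrs G i then c i j else 0)
  have hterm : ∀ i j : {v : V // v ∉ F}, 0 ≤ (if (j : V) ∈ inNbrs G i then c i j else 0) := by
    intro i j
    split_ifs
    exacts [hc0 i i.2 j, le_rfl]
  have hM : M ∈ rowStochastic ℝ {v : V // v ∉ F} := by
    rw [mem_rowStochastic_iff_sum]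
    refine ⟨fun i j => mul_nonneg (by positivity)
      (add_nonneg (by split_ifs <;> norm_num) (hterm i j)), fun i => ?_⟩
    rw [← Finset.mul_sum, Finset.sum_add_distrib, sum_subtype_ite_mem F (inNbrs G i) (c i),
      hcsum i i.2]
    simp only [Finset.sum_ite_eq', Finset.mem_univ, if_true]
    have : ((K i).card : ℝ) + 1 ≠ 0 := by positivity
    field_simp
    ring
  -- Cutting the at most `f` exceptional senders of each agent leaves exactly the edges with
  -- guaranteed weight.
  let H : Digraph {v : V // v ∉ F} := ⟨fun j i => G.Adj j i ∧ (j : V) ∉ E i⟩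
  refine ⟨M, hM, H, ⟨fun j i h => h.1, fun i => ?_⟩, fun i => ?_, fun i j hij => ?_, fun i => ?_⟩
  · refine (ncard_subtype_le _ (E i) fun j hj => ?_).trans (hE i i.2)
    by_contra hne
    exact hj.2 ⟨hj.1, hne⟩
  · refine (hunit_le i i.2).trans ?_
    refine le_mul_of_one_le_right (by positivity) ?_
    have := hterm i i
    simp only [if_true]
    linarith
  · have hadj : (j : V) ∈ inNbrs G i := mem_inNbrs.2 hij.1
    have h1 := hcE i i.2 j (Finset.mem_sdiff.2 ⟨hadj, j.2⟩) hij.2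
    refine mul_le_mul (hunit_le i i.2) ?_ (by positivity) (by positivity)
    simp only [hadj, if_true]
    have : (0 : ℝ) ≤ if j = i then 1 else 0 := by split_ifs <;> norm_num
    linarith
  · have hmv : (M *ᵥ fun j => x t j) i =
        1 / ((inDegree G i : ℝ) + 1 - 2 * f) * (x t i + ∑ j ∈ K i, w t j i) := by
      have h1 : (M *ᵥ fun j => x t j) i = 1 / ((K i).card + 1 : ℝ) *
          ∑ j : {v : V // v ∉ F}, ((if j = i then x t j else 0) +
            if (j : V) ∈ inNbrs G i then c i j * x t j else 0) := by
        rw [Finset.mul_sum]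
        refine Finset.sum_congr rfl fun j _ => ?_
        simp only [M, mul_assoc, add_mul, ite_mul, one_mul, zero_mul]
      rw [h1, Finset.sum_add_distrib,
        sum_subtype_ite_mem F (inNbrs G i) (fun j => c i j * x t j), hunit i i.2, hcw i i.2]
      simp only [Finset.sum_ite_eq', Finset.mem_univ, if_true]
      congr 2
      refine Finset.sum_congr rfl fun j hj => ?_
      rw [Finset.mem_sdiff, mem_inNbrs] at hj
      rw [hexec.honest t j hj.2 i i.2 hj.1]
    rw [hmv]
    exact hproj i i.2

lemma weightedArgmin_eq_optimalSet (F : Finset V) (h : V → ℝ → ℝ) (X : Set ℝ) (β : ℝ) (γ : ℕ) :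
    weightedArgmin X (fun i : {v : V // v ∉ F} => h i) β γ = optimalSet F h X β γ := by
  have hsum : ∀ u : V → ℝ, ∑ i : {v : V // v ∉ F}, u i = ∑ i ∈ Fᶜ, u i := fun u =>
    (Finset.sum_subtype Fᶜ (by simp) u).symm
  have hncard : ∀ α : V → ℝ, {i : {v : V // v ∉ F} | β ≤ α i}.ncard =
      {i : V | i ∈ Fᶜ ∧ β ≤ α i}.ncard := by
    intro α
    rw [← Set.ncard_image_of_injective _ Subtype.val_injective]
    congr 1
    ext i
    simp [and_comm]
  ext y
  simp only [weightedArgmin, optimalSet, validFunctions, validWeights, Set.mem_ofPred_eq,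
    Set.mem_iUnion, exists_prop]
  constructor
  · rintro ⟨α, ⟨hα, hcount⟩, hy⟩
    let α' : V → ℝ := fun i => if hi : i ∉ F then α ⟨i, hi⟩ else 0
    have hα' : ∀ i : {v : V // v ∉ F}, α' i = α i := fun i => by simp [α', i.2]
    refine ⟨_, ⟨α', fun i hi => ?_, ?_, ?_, rfl⟩, ?_⟩
    · exact (hα' ⟨i, by simpa using hi⟩) ▸ hα.1 _
    · rw [← hsum, ← hα.2]
      exact Finset.sum_congr rfl fun i _ => hα' i
    · rw [← hncard]
      simpa only [hα'] using hcount
    · convert hy using 2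
      funext z
      rw [← hsum fun i => α' i * h i z]
      exact Finset.sum_congr rfl fun i _ => by rw [hα' i]
  · rintro ⟨_, ⟨α, hα, hα1, hcount, rfl⟩, hy⟩
    refine ⟨fun i => α i, ⟨⟨fun i => hα i (by simpa using i.2), by rw [hsum, hα1]⟩, ?_⟩, ?_⟩
    · rw [hncard]
      exact hcount
    · convert hy using 2
      exact funext fun z => hsum fun i => α i * h i z

lemma tendsto_zero_of_summable_sq {u : ℕ → ℝ} (hu : Summable fun t => u t ^ 2) :
    Tendsto u atTop (𝓝 0) := by
  have h := hu.tendsto_atTop_zero.sqrt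
  simp only [Real.sqrt_sq_eq_abs, Real.sqrt_zero] at h
  exact (tendsto_zero_iff_abs_tendsto_zero u).2 h

end Execution

end ByzOpt

/-! ### Assembly of the main theorem. -/

theorem mainTheorem1 {V : Type*} [Fintype V] [DecidableEq V]
    -- the network, without self-loops, and the set of faulty agents
    (G : Digraph V) (hloop : ∀ v, ¬ G.Adj v v)
    (f : ℕ) (F : Finset V) (hF : F.card ≤ f)
    -- standing assumption: whichever agents are faulty, every reduced graph has a source component
    (hG : ∀ F' : Finset V, F'.card ≤ f → ∀ H, ByzOpt.IsReducedGraph G f F' H →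
      (ByzOpt.sourceComponent H).Nonempty)
    (γ : ℕ) (hγ : f + 1 ≤ γ)
    (hsource : ∀ H, ByzOpt.IsReducedGraph G f F H → γ ≤ (ByzOpt.sourceComponent H).ncard)
    (β : ℝ)
    (hβ : β ≤ 1 / (2 * ((ByzOpt.maxInDegree G : ℝ) + 1 - 2 * f)) ^
      (ByzOpt.numReducedGraphs G f F * (Fintype.card V - F.card)))
    -- the constraint set and the cost functions
    (X : Set ℝ) (hXne : X.Nonempty) (hXclosed : IsClosed X) (hXconvex : Convex ℝ X)
    (L : ℝ) (h h' : V → ℝ → ℝ) (hadm : ∀ i, ByzOpt.Admissible X L (h i) (h' i))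
    -- the stepsizes
    (stepsize : ℕ → ℝ) (hmono : Antitone stepsize)
    (hsum : Tendsto (fun T => ∑ t ∈ Finset.range T, stepsize t) atTop atTop)
    (hsq : Summable fun t => stepsize t ^ 2)
    -- an arbitrary execution
    (x : ℕ → V → ℝ) (w : ℕ → V → V → ℝ)
    (hexec : ByzOpt.IsExecution G f F X h' stepsize x w) :
    (ByzOpt.optimalSet F h X β γ).Nonempty ∧
      (∀ i ∉ F, Tendsto (fun t => Metric.infDist (x t i) (ByzOpt.optimalSet F h X β γ))
        atTop (𝓝 0)) ∧
      (∀ i ∉ F, ∀ j ∉ F, Tendsto (fun t => |x t i - x t j|) atTop (𝓝 0)) := by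
  open ByzOpt Matrix in
  classical
  -- the averaging matrices
  have hdeg : 0 < f → ∀ i, inDegree G i ≠ 2 * f := fun hf => inDegree_ne_two_mul hloop hf hG
  choose M hM Hs hHs hdiag hedge hupd using hexec.exists_matrix hF hdeg
  obtain ⟨i₀, -⟩ := hG F hF (Hs 0) (hHs 0)
  have : Nonempty {v : V // v ∉ F} := ⟨i₀⟩
  set m := Fintype.card {v : V // v ∉ F} with hm
  have hmcard : Fintype.card V - F.card = m := by
    rw [hm, Fintype.card_subtype_compl, Fintype.card_coe]
  have hmpos : 0 < m := Fintype.card_pos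
  set τ := numReducedGraphs G f F with hτ
  set d : ℝ := (maxInDegree G : ℝ) + 1 - 2 * f with hd
  rw [hmcard] at hβ
  obtain ⟨hdeg₀, hτf⟩ : 2 * f ≤ inDegree G i₀ ∧ f < τ := by
    obtain ⟨K, hK, -⟩ := hexec.update 0 i₀ i₀.2
    have := hK.card_add
    have h2 : 2 * f ≤ inDegree G i₀ := by rw [inDegree]; omega
    exact ⟨h2, lt_numReducedGraphs hF i₀.2 h2⟩
  have hd1 : 1 ≤ d := by
    have h1 : 2 * f ≤ maxInDegree G := hdeg₀.trans (Finset.le_sup (Finset.mem_univ _))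
    have h2 : (2 * f : ℝ) ≤ maxInDegree G := by exact_mod_cast h1
    linarith
  -- the lower bound for the entries of the products
  have hδβ : β ≤ (1 / d) ^ (τ * m) * ((1 / 2) ^ (f + 1)) ^ m := by
    refine hβ.trans ?_
    have h1 : (1 : ℝ) / (2 * d) ^ (τ * m) = (1 / d) ^ (τ * m) * (1 / 2) ^ (τ * m) := by
      rw [← mul_pow, ← _root_.one_div_pow]
      congr 1
      field_simp
    rw [h1, ← pow_mul]
    refine mul_le_mul_of_nonneg_left ?_ (by positivity)
    exact pow_le_pow_of_le_one (by norm_num) (by norm_num) (Nat.mul_le_mul_right m hτf)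
  have hδpos : 0 < (1 / d) ^ (τ * m) * ((1 / 2 : ℝ) ^ (f + 1)) ^ m := by positivity
  have hβm : β ≤ (m : ℝ)⁻¹ := by
    refine hβ.trans ?_
    rw [← one_div]
    refine one_div_le_one_div_of_le (by exact_mod_cast hmpos) ?_
    calc (m : ℝ) ≤ 2 ^ m := by exact_mod_cast Nat.lt_two_pow_self.le
      _ ≤ 2 ^ (τ * m) := pow_le_pow_right₀ (by norm_num)
        (Nat.le_mul_of_pos_left m (by omega))
      _ ≤ (2 * d) ^ (τ * m) := pow_le_pow_left₀ (by norm_num) (by linarith) _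
  have hγm : γ ≤ m := by
    refine (hsource (Hs 0) (hHs 0)).trans ?_
    rw [hm, ← Nat.card_eq_fintype_card, ← Set.ncard_univ]
    exact Set.ncard_le_ncard (Set.subset_univ _) (Set.toFinite _)
  -- Time is shifted by one here and below, since the initial states may lie outside `X`.
  have hcol : ∀ t, ∃ H, IsReducedGraph G f F H ∧ ∀ j ∈ sourceComponent H, ∀ i,
      (1 / d) ^ (τ * m) * ((1 / 2) ^ (f + 1)) ^ m ≤
        stepProduct (fun t => M (t + 1)) t (τ * m) i j := by
    intro t
    have hfin := finite_setOf_isReducedGraph G f F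
    have hcard : hfin.toFinset.card = τ := by
      rw [hτ, numReducedGraphs, Set.ncard_eq_toFinset_card _ hfin]
    obtain ⟨H, hH, hlarge⟩ := exists_large_columns (M := fun t => M (t + 1)) (a := 1 / d)
      (κ := (1 / 2) ^ (f + 1)) (fun t => hM _) (by positivity) (by positivity)
      (pow_le_one₀ (by norm_num) (by norm_num)) (fun t => hdiag _) (fun t => Hs (t + 1))
      (fun t => hedge _) hfin.toFinset (fun t => by simpa using hHs (t + 1)) t
    rw [hcard] at hlarge
    exact ⟨H, by simpa using hH, hlarge⟩
  -- step sizes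
  have hlam0 : Tendsto stepsize atTop (𝓝 0) := tendsto_zero_of_summable_sq hsq
  have hlam : ∀ t, 0 ≤ stepsize t := fun t => hmono.le_of_tendsto hlam0 t
  have hlam0' : Tendsto (fun t => stepsize (t + 1)) atTop (𝓝 0) :=
    hlam0.comp (tendsto_add_atTop_nat 1)
  have hsum' : Tendsto (fun T => ∑ t ∈ Finset.range T, stepsize (t + 1)) atTop atTop := by
    have h1 := (tendsto_atTop_add_const_right atTop (-stepsize 0) hsum).comp
      (tendsto_add_atTop_nat 1)
    refine h1.congr fun T => ?_
    simp [Finset.sum_range_succ']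
  -- consensus
  have hmem : ∀ t (i : {v : V // v ∉ F}), x (t + 1) i ∈ X := fun t i => (hupd t i).1
  have hcons : ∀ i j : {v : V // v ∉ F},
      Tendsto (fun t => |x (t + 1) i - x (t + 1) j|) atTop (𝓝 0) := by
    refine tendsto_consensus (M := fun t => M (t + 1))
      (x := fun t (i : {v : V // v ∉ F}) => x (t + 1) i)
      (η := fun t => L * stepsize (t + 1)) (ν := τ * m) (fun t => hM _) (fun t i => ?_)
      (by simpa using hlam0'.const_mul L) (Nat.mul_pos (by omega) hmpos) hδpos fun t => ?_
    · exact abs_step_le hXconvex (hlam _) ((hadm i).bounded_gradient _ (hmem t i))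
        (mulVec_mem_of_convex hXconvex (hM _) (hmem t) i) (hupd (t + 1) i)
    · obtain ⟨H, hH, hlarge⟩ := hcol t
      obtain ⟨j, hj⟩ := hG F hF H hH
      exact ⟨j, hlarge j hj⟩
  -- absolute probabilities
  obtain ⟨p, hp, hpM⟩ := exists_absoluteProbability (M := fun t => M (t + 1)) fun t => hM _
  have hvalid : ∀ t, p t ∈ validWeights {v : V // v ∉ F} β γ := by
    intro t
    obtain ⟨H, hH, hlarge⟩ := hcol t
    refine ⟨hp t, (hsource H hH).trans (Set.ncard_le_ncard (fun j hj => ?_) (Set.toFinite _))⟩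
    exact hδβ.trans (le_absoluteProbability hp hpM (hlarge j hj))
  have hD : IsDescent X L (fun i : {v : V // v ∉ F} => h' i) (fun t => M (t + 1))
      (fun t => stepsize (t + 1)) (fun t i => x (t + 1) i) p :=
    { convex := hXconvex
      monotone := fun i => (hadm i).monotoneOn
      bounded := fun i => (hadm i).bounded_gradient
      stochastic := fun t => hM _
      mem_simplex := hp
      absolute := hpM
      mem := hmem
      update := fun t i => hupd (t + 1) i
      step_nonneg := fun t => hlam _
      step_tendsto := hlam0'
      step_sum := hsum'
      consensus := hcons }
  have hadm' : ∀ i : {v : V // v ∉ F}, Admissible X L (h i) (h' i) := fun i => hadm i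
  rw [← weightedArgmin_eq_optimalSet]
  refine ⟨weightedArgmin_nonempty hXconvex hadm' hγm hβm, fun i hi => ?_, fun i hi j hj => ?_⟩
  · exact (tendsto_add_atTop_iff_nat 1).1
      (hD.tendsto_infDist hadm' hγm hβm hvalid ⟨i, hi⟩)
  · exact (tendsto_add_atTop_iff_nat (f := fun t => |x t i - x t j|) 1).1
      (hcons ⟨i, hi⟩ ⟨j, hj⟩)
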